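/- Let $n\ge 3$, let $\Gamma$ be a connected simple graph on $[n]=\{1,\dots,n\}$, and write $\mathbb{C}[t_\bullet]=\mathbb{C}[t_1,\dots,t_n]$. The ring of splines is the subring $$\mathcal{S}_\Gamma=\Bigl\{\rho\in\prod_{w\in S_n}\mathbb{C}[t_\bullet]\;\Big|\;\rho(w)-\rho(w(i,j))\in\langle t_{w(i)}-t_{w(j)}\rangle\text{ for all }w\in S_n\text{ and all edges }(i,j)\text{ of }\Gamma\Bigr\}$$ with pointwise operations, graded by polynomial degree; $\mathcal{S}_\Gamma^1$ is the space of splines all of whose values are homogeneous of degree $1$ (or zero). Let $\bar t_i,\bar x_i\in\mathcal{S}_\Gamma$ be the splines $\bar t_i(w)=t_i$ and $\bar x_i(w)=t_{w(i)}$, and let $\mathrm{L}_\Gamma=\mathcal{S}_\Gamma/\langle\bar t_1,\dots,\bar t_n\rangle$ and $\mathrm{R}_\Gamma=\mathcal{S}_\Gamma/\langle\bar x_1,\dots,\bar x_n\rangle$ with the induced gradings. A vertex $j$ is a cut vertex if $\Gamma-j$ is disconnected, and then $\mathfrak{c}(j)+1$ denotes the number of connected components of $\Gamma-j$. A block is a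 maximal $2$-connected subgraph of $\Gamma$, where a graph is $2$-connected if it is connected and stays connected (in particular non-empty) after removal of any one vertex, so that a single edge is $2$-connected. The block-cut tree has the cut vertices and the blocks of $\Gamma$ as its vertices, with $v$ joined to $B$ when $v\in B$. Let $\mathrm{LB}_\Gamma$ be the set of blocks that are leaves (vertices of degree $1$) of the block-cut tree and $\mathrm{IB}_\Gamma$ the set of all other blocks (so if $\Gamma$ itself is $2$-connected, then $\mathrm{LB}_\Gamma=\emptyset$ and $\mathrm{IB}_\Gamma=\{\Gamma\}$). Let $\mathrm{IC}_\Gamma$ be the set of edges $(i,j)$ of $\Gamma$ such that $\{i,j\}$ is the vertex set of some $B\in\mathrm{IB}_\Gamma$. For $s\in\mathrm{IC}_\Gamma$ let $G_s$ be either of the two connected components of $([n],E(\Gamma)\setminus\{s\})$, and $|G_s|$ its number of vertices. Put $$D_\Gamma=2n-1-\sum_{j\text{ cut vertex}}\mathfrak{c}(j)+n\Bigl(|\mathrm{LB}_\Gamma|+\bigl|\{B\in\mathrm{IB}_\Gamma:|B|>2\}\bigr|-1\Bigr)+\sum_{s\in\mathrm{IC}_\Gamma}\binom{n}{|G_s|}.$$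 Then, for every choice of the components $G_s$, $\dim_{\mathbb{C}}\mathcal{S}_\Gamma^1=D_\Gamma$. Moreover, the degree-$1$ pieces of the two quotients satisfy $\dim_{\mathbb{C}}(\mathrm{L}_\Gamma)_1=\dim_{\mathbb{C}}(\mathrm{R}_\Gamma)_1=D_\Gamma-n$. -/

import Mathlib

namespace CayleySplines

/-! ### Graph theory -/

/-- `G` is `k`-connected: `G ∖ A` is connected for every vertex set `A` with `|A| ≤ k - 1`.
(`Connected` includes non-emptiness of the vertex set.) -/
def IsKConnected {V : Type*} (G : SimpleGraph V) (k : ℕ) : Prop :=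
  ∀ A : Set V, A.encard < k → (G.induce Aᶜ).Connected

/-- `v` is a cut vertex: `Γ - v` is disconnected. -/
def IsCutVertex {V : Type*} (Γ : SimpleGraph V) (v : V) : Prop :=
  ¬ (Γ.induce {v}ᶜ).Connected

/-- A block: a maximal `2`-connected subgraph. -/
def IsBlock {V : Type*} (Γ : SimpleGraph V) (B : Γ.Subgraph) : Prop :=
  Maximal (fun H : Γ.Subgraph => IsKConnected H.coe 2) B

/-- The block-cut tree: its vertices are the cut vertices and the blocks of `Γ`, and a cut vertex
`v` is joined to a block `B` when `v ∈ B`. -/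
def blockCutTree {V : Type*} (Γ : SimpleGraph V) :
    SimpleGraph ({v : V // IsCutVertex Γ v} ⊕ {B : Γ.Subgraph // IsBlock Γ B}) :=
  SimpleGraph.fromRel fun x y =>
    match x, y with
    | Sum.inl v, Sum.inr B => v.1 ∈ B.1.verts
    | _, _ => False

/-- Leaf blocks: blocks that are leaves (vertices of degree one) of the block-cut tree. -/
def leafBlocks {V : Type*} (Γ : SimpleGraph V) : Set Γ.Subgraph :=
  {B | ∃ h : IsBlock Γ B, ((blockCutTree Γ).neighborSet (Sum.inr ⟨B, h⟩)).ncard = 1}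

/-- Internal blocks: blocks that are not leaves of the block-cut tree. -/
def internalBlocks {V : Type*} (Γ : SimpleGraph V) : Set Γ.Subgraph :=
  {B | IsBlock Γ B ∧ B ∉ leafBlocks Γ}

/-- Internal cut edges: edges whose two endpoints are the vertex set of an internal block. -/
def internalCutEdges {V : Type*} (Γ : SimpleGraph V) : Set (Sym2 V) :=
  {s | s ∈ Γ.edgeSet ∧ ∃ B ∈ internalBlocks Γ, B.verts = {v | v ∈ s}}

/-- `𝔠(j)`: one less than the number of connected components of `Γ - j`. -/
noncomputable def cutNumber {V : Type*} (Γ : SimpleGraph V) (j : V) : ℤ :=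
  (Nat.card (Γ.induce {j}ᶜ).ConnectedComponent : ℤ) - 1

open Classical in
/-- The number `D_Γ` of a graph `Γ` on `n` vertices. The argument `G` chooses, for each edge `s`,
a connected component `G_s` of `Γ` with `s` deleted. -/
noncomputable def linDim {n : ℕ} (Γ : SimpleGraph (Fin n))
    (G : ∀ s : Sym2 (Fin n), (Γ.deleteEdges {s}).ConnectedComponent) : ℤ :=
  2 * (n : ℤ) - 1
    - ∑ j : Fin n with IsCutVertex Γ j, cutNumber Γ j
    + (n : ℤ) * (((leafBlocks Γ).ncard : ℤ)
        + (({B ∈ internalBlocks Γ | 2 < B.verts.ncard}).ncard : ℤ) - 1)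
    + ∑ s : Sym2 (Fin n) with s ∈ internalCutEdges Γ, (n.choose (G s).supp.ncard : ℤ)

/-! ### Splines -/

/-- The ring of splines on the labelled Cayley graph of `S_n` attached to `Γ`: functions
`ρ : S_n → ℂ[t₁, …, tₙ]` with `ρ(w) - ρ(w (i j)) ∈ ⟨t_{w(i)} - t_{w(j)}⟩` for every edge
`(i, j)` of `Γ`. -/
noncomputable def splines {n : ℕ} (Γ : SimpleGraph (Fin n)) :
    Subalgebra ℂ (Equiv.Perm (Fin n) → MvPolynomial (Fin n) ℂ) where
  carrier := {ρ | ∀ (w : Equiv.Perm (Fin n)) (i j : Fin n), Γ.Adj i j →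
    ρ w - ρ (w * Equiv.swap i j) ∈
      Ideal.span {(MvPolynomial.X (w i) - MvPolynomial.X (w j) : MvPolynomial (Fin n) ℂ)}}
  mul_mem' := by
    intro a b ha hb w i j hij
    have h : (a * b) w - (a * b) (w * Equiv.swap i j)
        = a w * (b w - b (w * Equiv.swap i j))
          + b (w * Equiv.swap i j) * (a w - a (w * Equiv.swap i j)) := by
      simp only [Pi.mul_apply]; ring
    rw [h]
    exact Ideal.add_mem _ (Ideal.mul_mem_left _ _ (hb w i j hij))
      (Ideal.mul_mem_left _ _ (ha w i j hij))
  add_mem' := by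
    intro a b ha hb w i j hij
    have h : (a + b) w - (a + b) (w * Equiv.swap i j)
        = (a w - a (w * Equiv.swap i j)) + (b w - b (w * Equiv.swap i j)) := by
      simp only [Pi.add_apply]; ring
    rw [h]
    exact Ideal.add_mem _ (ha w i j hij) (hb w i j hij)
  algebraMap_mem' := by
    intro r w i j _
    simp [Pi.algebraMap_apply]

/-- The degree `d` piece of the ring of splines. -/
def splinesDeg {n : ℕ} (Γ : SimpleGraph (Fin n)) (d : ℕ) : Submodule ℂ (splines Γ) where
  carrier := {ρ | ∀ w, (ρ.1 w).IsHomogeneous d}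
  zero_mem' := fun _ => MvPolynomial.isHomogeneous_zero _ _ _
  add_mem' := fun ha hb w => (ha w).add (hb w)
  smul_mem' := by
    intro c ρ h w
    have := (MvPolynomial.isHomogeneous_C (Fin n) c).mul (h w)
    simpa [MvPolynomial.smul_eq_C_mul] using this

/-- The spline `t̄ᵢ`, with `t̄ᵢ(w) = tᵢ`. -/
noncomputable def tSpline {n : ℕ} (Γ : SimpleGraph (Fin n)) (i : Fin n) : splines Γ :=
  ⟨fun _ => MvPolynomial.X i, by intro w a b _; simp⟩

/-- The spline `x̄ᵢ`, with `x̄ᵢ(w) = t_{w(i)}`. -/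
noncomputable def xSpline {n : ℕ} (Γ : SimpleGraph (Fin n)) (i : Fin n) : splines Γ :=
  ⟨fun w => MvPolynomial.X (w i), by
    intro w a b _
    rw [Ideal.mem_span_singleton]
    by_cases ha : i = a
    · subst ha; simp
    · by_cases hb : i = b
      · subst hb
        exact ⟨-1, by simp⟩
      · simp [Equiv.swap_apply_of_ne_of_ne ha hb]⟩

/-- The ideal `⟨t̄₁, …, t̄ₙ⟩` of the ring of splines. -/
noncomputable def leftIdeal {n : ℕ} (Γ : SimpleGraph (Fin n)) : Ideal (splines Γ) :=
  Ideal.span (Set.range (tSpline Γ))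

/-- The ideal `⟨x̄₁, …, x̄ₙ⟩` of the ring of splines. -/
noncomputable def rightIdeal {n : ℕ} (Γ : SimpleGraph (Fin n)) : Ideal (splines Γ) :=
  Ideal.span (Set.range (xSpline Γ))

/-- The left quotient `L_Γ`. -/
abbrev LeftQuotient {n : ℕ} (Γ : SimpleGraph (Fin n)) : Type := splines Γ ⧸ leftIdeal Γ

/-- The right quotient `R_Γ`. -/
abbrev RightQuotient {n : ℕ} (Γ : SimpleGraph (Fin n)) : Type := splines Γ ⧸ rightIdeal Γ

/-- The degree `d` piece of `L_Γ`: the image of the degree `d` splines. -/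
noncomputable def leftDeg {n : ℕ} (Γ : SimpleGraph (Fin n)) (d : ℕ) :
    Submodule ℂ (LeftQuotient Γ) :=
  (splinesDeg Γ d).map (Ideal.Quotient.mkₐ ℂ (leftIdeal Γ)).toLinearMap

/-- The degree `d` piece of `R_Γ`: the image of the degree `d` splines. -/
noncomputable def rightDeg {n : ℕ} (Γ : SimpleGraph (Fin n)) (d : ℕ) :
    Submodule ℂ (RightQuotient Γ) :=
  (splinesDeg Γ d).map (Ideal.Quotient.mkₐ ℂ (rightIdeal Γ)).toLinearMap

end CayleySplines

/-!
Write the value at `w` of a linear spline as `∑ v, Φ v w * t_{w(v)}`. The spline condition along an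
edge `(i, j)` says that `Φ i + Φ j` and all `Φ k` with `k ≠ i, j` are invariant under
`w ↦ w (i, j)`. As `Γ` is connected, `∑ v, Φ v` is a constant, which contributes one dimension, and
the families with `∑ v, Φ v = 0` remain. The gate of a vertex `p` in a block `B` is the vertex of
`B` through which every walk from `p` to `B` enters `B`. Adding up `Φ` over the fibres of the gate
map gives a family indexed by the vertices of `B`, and `Φ` is the sum of these families over all
blocks, because the number of blocks in which `p` has gate `i` is the number of blocks containing
`i`, less one when `p ≠ i`.

The family of a block `B` consists of functions of the images under `w` of the fibres of the gate
map. If `B` has at least three vertices, the change of such a function when the values `a` and `b`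
of `w` at points of different fibres are exchanged depends only on `a` and `b` and is a cocycle
`μ a - μ b`. Hence the family is affine in `μ`, and such families form a space of dimension
`n + |B| - 2`. If `B` has two vertices, the family is a single function of the subsets of `[n]` of
size `|G_s|`, whence the binomial coefficient; it equals `n = n + |B| - 2` when `B` is a leaf. Since
each vertex `j` lies in `𝔠(j) + 1` blocks and `∑ (|B| - 1) = n - 1`, the total is `D_Γ`.

For the quotients, the constant terms of the values of a spline agree, so a linear spline in the
ideal generated by the `t̄ᵢ`, or by the `x̄ᵢ`, is a constant combination of the generators.
-/

namespace CayleySplines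

open Equiv Equiv.Perm Finset
open scoped Pointwise

/-! ### Walks inside a set of vertices -/

section ReachableIn

variable {V : Type*} {Γ : SimpleGraph V} {S T : Set V} {p q r : V}

/-- `p` and `q` are joined by a walk of `Γ` all of whose vertices lie in `S`. Unlike reachability in
`Γ.induce S`, this needs no membership proofs for `p` and `q`. -/
def ReachableIn (Γ : SimpleGraph V) (S : Set V) (p q : V) : Prop :=
  ∃ W : Γ.Walk p q, ∀ x ∈ W.support, x ∈ S

lemma ReachableIn.refl (hp : p ∈ S) : ReachableIn Γ S p p :=
  ⟨.nil, by simpa using hp⟩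

lemma ReachableIn.symm (h : ReachableIn Γ S p q) : ReachableIn Γ S q p := by
  obtain ⟨W, hW⟩ := h
  exact ⟨W.reverse, by simpa using hW⟩

lemma ReachableIn.trans (h : ReachableIn Γ S p q) (h' : ReachableIn Γ S q r) :
    ReachableIn Γ S p r := by
  obtain ⟨W, hW⟩ := h
  obtain ⟨W', hW'⟩ := h'
  exact ⟨W.append W', fun x hx =>
    (SimpleGraph.Walk.mem_support_append_iff _ _ |>.mp hx).elim (hW x) (hW' x)⟩

lemma ReachableIn.mono (hST : S ⊆ T) (h : ReachableIn Γ S p q) : ReachableIn Γ T p q := by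
  obtain ⟨W, hW⟩ := h
  exact ⟨W, fun x hx => hST (hW x hx)⟩

lemma ReachableIn.of_adj (h : Γ.Adj p q) (hp : p ∈ S) (hq : q ∈ S) : ReachableIn Γ S p q :=
  ⟨h.toWalk, by simp [hp, hq]⟩

lemma ReachableIn.left_mem (h : ReachableIn Γ S p q) : p ∈ S := by
  obtain ⟨W, hW⟩ := h
  exact hW _ W.start_mem_support

lemma ReachableIn.right_mem (h : ReachableIn Γ S p q) : q ∈ S :=
  h.symm.left_mem

lemma ReachableIn.reflTransGen (h : ReachableIn Γ S p q) :
    Relation.ReflTransGen (fun i j => Γ.Adj i j ∧ i ∈ S ∧ j ∈ S) p q := by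
  obtain ⟨W, hW⟩ := h
  induction W with
  | nil => exact .refl
  | cons hadj W' ih =>
    exact .head ⟨hadj, hW _ (by simp), hW _ (by simp)⟩ (ih fun x hx => hW x (by simp [hx]))

lemma reachableIn_iff_reachable_induce (hp : p ∈ S) (hq : q ∈ S) :
    ReachableIn Γ S p q ↔ (Γ.induce S).Reachable ⟨p, hp⟩ ⟨q, hq⟩ := by
  constructor
  · rintro ⟨W, hW⟩
    exact ⟨W.induce S hW⟩
  · rintro ⟨W⟩
    refine ⟨W.map (SimpleGraph.Embedding.induce S).toHom, fun x hx => ?_⟩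
    obtain ⟨y, -, rfl⟩ := List.mem_map.mp (W.support_map _ ▸ hx)
    exact y.2

lemma induce_connected_iff_exists_reachableIn :
    (Γ.induce S).Connected ↔ ∃ u ∈ S, ∀ q ∈ S, ReachableIn Γ S u q := by
  rw [SimpleGraph.connected_iff_exists_forall_reachable]
  constructor
  · rintro ⟨⟨u, hu⟩, h⟩
    exact ⟨u, hu, fun q hq => (reachableIn_iff_reachable_induce hu hq).mpr (h ⟨q, hq⟩)⟩
  · rintro ⟨u, hu, h⟩
    exact ⟨⟨u, hu⟩, fun q => (reachableIn_iff_reachable_induce hu q.2).mp (h q.1 q.2)⟩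

lemma reachableIn_of_induce_connected (h : (Γ.induce S).Connected) (hp : p ∈ S) (hq : q ∈ S) :
    ReachableIn Γ S p q :=
  (reachableIn_iff_reachable_induce hp hq).mpr (h.preconnected _ _)

lemma reachableIn_compl_of_isPath {P : Γ.Walk p q} (hP : P.IsPath) (hr : r ∈ P.support)
    (hrp : r ≠ p) : ReachableIn Γ {p}ᶜ r q := by
  obtain ⟨Q, R, rfl⟩ := SimpleGraph.Walk.mem_support_iff_exists_append.mp hr
  exact ⟨R, fun x hx hxp => hP.ne_of_mem_support_of_append (hxp ▸ hrp.symm)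
    Q.start_mem_support hx (Eq.symm hxp)⟩

end ReachableIn

/-! ### Two-connected vertex sets and blocks -/

section TwoConnected

variable {V : Type*} {Γ : SimpleGraph V} {S T : Set V}

/-- `T` induces a `2`-connected subgraph of `Γ`. -/
def TwoConnected (Γ : SimpleGraph V) (T : Set V) : Prop :=
  (Γ.induce T).Connected ∧ ∀ x ∈ T, (Γ.induce (T \ {x})).Connected

lemma TwoConnected.reachableIn (h : TwoConnected Γ T) {x p q : V} (hp : p ∈ T) (hq : q ∈ T)
    (hpx : p ≠ x) (hqx : q ≠ x) : ReachableIn Γ (T \ {x}) p q := by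
  by_cases hx : x ∈ T
  · exact reachableIn_of_induce_connected (h.2 x hx) ⟨hp, hpx⟩ ⟨hq, hqx⟩
  · rw [Set.sdiff_singleton_eq_self hx]
    exact reachableIn_of_induce_connected h.1 hp hq

lemma TwoConnected.exists_ne (h : TwoConnected Γ T) (x : V) : ∃ y ∈ T, y ≠ x := by
  by_cases hx : x ∈ T
  · obtain ⟨y, hy⟩ := (h.2 x hx).nonempty
    exact ⟨y, hy.1, hy.2⟩
  · obtain ⟨y, hy⟩ := h.1.nonempty
    exact ⟨y, hy, fun e => hx (e ▸ hy)⟩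

lemma TwoConnected.exists_adj (h : TwoConnected Γ T) {v : V} (hv : v ∈ T) :
    ∃ j ∈ T, Γ.Adj v j := by
  obtain ⟨y, hy, hyv⟩ := h.exists_ne v
  obtain ⟨W, hW⟩ := reachableIn_of_induce_connected h.1 hv hy
  cases W with
  | nil => exact absurd rfl hyv
  | cons hadj W' => exact ⟨_, hW _ (by simp), hadj⟩

lemma twoConnected_pair {i j : V} (h : Γ.Adj i j) : TwoConnected Γ {i, j} := by
  refine ⟨SimpleGraph.induce_pair_connected_of_adj h, ?_⟩
  rintro x (rfl | rfl)
  · rw [Set.pair_sdiff_left h.ne]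
    exact ⟨.of_subsingleton⟩
  · rw [Set.pair_sdiff_right h.ne]
    exact ⟨.of_subsingleton⟩

lemma TwoConnected.union (hS : TwoConnected Γ S) (hT : TwoConnected Γ T) {a b : V}
    (hab : a ≠ b) (haS : a ∈ S) (haT : a ∈ T) (hbS : b ∈ S) (hbT : b ∈ T) :
    TwoConnected Γ (S ∪ T) := by
  refine ⟨SimpleGraph.induce_union_connected hS.1.preconnected hT.1.preconnected ⟨a, haS, haT⟩,
    fun x _ => ?_⟩
  obtain ⟨c, hcS, hcT, hcx⟩ : ∃ c, c ∈ S ∧ c ∈ T ∧ c ≠ x := by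
    by_cases h : a = x
    · exact ⟨b, hbS, hbT, fun e => hab (h.trans e.symm)⟩
    · exact ⟨a, haS, haT, h⟩
  refine induce_connected_iff_exists_reachableIn.mpr ⟨c, ⟨Or.inl hcS, hcx⟩, ?_⟩
  rintro q ⟨hq | hq, hqx⟩
  · exact (hS.reachableIn hcS hq hcx hqx).mono (Set.sdiff_subset_sdiff_left Set.subset_union_left)
  · exact (hT.reachableIn hcT hq hcx hqx).mono (Set.sdiff_subset_sdiff_left Set.subset_union_right)

lemma reachableIn_support_sdiff {a b x y : V} {P : Γ.Walk a b} (hP : P.IsPath)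
    (hy : y ∈ P.support) (hxy : x ≠ y) :
    ReachableIn Γ ({z | z ∈ P.support} \ {x}) a y ∨
      ReachableIn Γ ({z | z ∈ P.support} \ {x}) y b := by
  obtain ⟨Q, R, rfl⟩ := SimpleGraph.Walk.mem_support_iff_exists_append.mp hy
  by_cases hx : x ∈ Q.support
  · refine Or.inr ⟨R, fun z hz => ⟨Q.support_subset_support_append_right R hz, fun e => ?_⟩⟩
    exact hP.ne_of_mem_support_of_append (e ▸ hxy) hx hz (Eq.symm e)
  · exact Or.inl ⟨Q, fun z hz => ⟨Q.support_subset_support_append_left R hz, fun e => hx (e ▸ hz)⟩⟩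

lemma twoConnected_insert_support {v j j' : V} {P : Γ.Walk j j'} (hP : P.IsPath)
    (hv : v ∉ P.support) (hj : Γ.Adj v j) (hj' : Γ.Adj v j') :
    TwoConnected Γ (insert v {z | z ∈ P.support}) := by
  have hjP : j ∈ {z | z ∈ P.support} := P.start_mem_support
  constructor
  · refine induce_connected_iff_exists_reachableIn.mpr ⟨v, by simp, ?_⟩
    rintro q (rfl | hq)
    · exact .refl (by simp)
    · exact (ReachableIn.of_adj hj (by simp) (Or.inr hjP)).trans
        ((reachableIn_of_induce_connected P.connected_induce_support hjP hq).mono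
          (Set.subset_insert _ _))
  · rintro x (rfl | hx)
    · rw [Set.insert_sdiff_self_of_notMem (show x ∉ {z | z ∈ P.support} from hv)]
      exact P.connected_induce_support
    · have hvx : v ≠ x := fun e => hv (e ▸ hx)
      have hsub : {z | z ∈ P.support} \ {x} ⊆ insert v {z | z ∈ P.support} \ {x} :=
        Set.sdiff_subset_sdiff_left (Set.subset_insert _ _)
      have hvT : v ∈ insert v {z | z ∈ P.support} \ {x} := ⟨by simp, hvx⟩
      refine induce_connected_iff_exists_reachableIn.mpr ⟨v, hvT, ?_⟩
      rintro q ⟨rfl | hq, hqx⟩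
      · exact .refl hvT
      · rcases reachableIn_support_sdiff hP hq (Ne.symm hqx) with h | h
        · exact (ReachableIn.of_adj hj hvT (hsub h.left_mem)).trans (h.mono hsub)
        · exact (ReachableIn.of_adj hj' hvT (hsub h.right_mem)).trans (h.mono hsub).symm

lemma exists_twoConnected_of_reachableIn_compl {v j j' : V} (hj : Γ.Adj v j) (hj' : Γ.Adj v j')
    (h : ReachableIn Γ {v}ᶜ j j') : ∃ T, TwoConnected Γ T ∧ v ∈ T ∧ j ∈ T ∧ j' ∈ T := by
  classical
  obtain ⟨W, hW⟩ := h
  have hv : v ∉ W.bypass.support := fun hx => hW v (W.support_bypass_subset_support hx) rfl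
  exact ⟨_, twoConnected_insert_support W.bypass_isPath hv hj hj', by simp, by simp, by simp⟩

end TwoConnected

section BlockSet

variable {V : Type*} {Γ : SimpleGraph V}

/-- The vertex sets of the blocks of `Γ`. -/
abbrev BlockSet (Γ : SimpleGraph V) := {T : Set V // Maximal (TwoConnected Γ) T}

noncomputable instance [Finite V] : Fintype (BlockSet Γ) := Fintype.ofFinite _

noncomputable instance [Finite V] (B : BlockSet Γ) : Fintype B.1 := Fintype.ofFinite _

lemma BlockSet.twoConnected (B : BlockSet Γ) : TwoConnected Γ B.1 := B.2.prop

lemma exists_blockSet_of_twoConnected [Finite V] {T : Set V} (h : TwoConnected Γ T) :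
    ∃ B : BlockSet Γ, T ⊆ B.1 := by
  obtain ⟨B, hB, hmax⟩ := Finite.exists_le_maximal h
  exact ⟨⟨B, hmax⟩, hB⟩

lemma exists_blockSet_of_adj [Finite V] {i j : V} (h : Γ.Adj i j) :
    ∃ B : BlockSet Γ, i ∈ B.1 ∧ j ∈ B.1 := by
  obtain ⟨B, hB⟩ := exists_blockSet_of_twoConnected (twoConnected_pair h)
  exact ⟨B, hB (by simp), hB (by simp)⟩

lemma BlockSet.eq_of_two_mem {B B' : BlockSet Γ} {a b : V} (hab : a ≠ b) (ha : a ∈ B.1)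
    (hb : b ∈ B.1) (ha' : a ∈ B'.1) (hb' : b ∈ B'.1) : B = B' := by
  have h := B.twoConnected.union B'.twoConnected hab ha ha' hb hb'
  exact Subtype.ext ((B.2.eq_of_subset h Set.subset_union_left).trans
    (B'.2.eq_of_subset h Set.subset_union_right).symm)

lemma BlockSet.eq_of_reachableIn_compl [Finite V] {B B' : BlockSet Γ} {v b b' : V} (hv : v ∈ B.1)
    (hv' : v ∈ B'.1) (hb : b ∈ B.1) (hb' : b' ∈ B'.1) (h : ReachableIn Γ {v}ᶜ b b') : B = B' := by
  have hsub (S : Set V) : S \ {v} ⊆ {v}ᶜ := fun x hx => hx.2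
  obtain ⟨j, hj, hvj⟩ := B.twoConnected.exists_adj hv
  obtain ⟨j', hj', hvj'⟩ := B'.twoConnected.exists_adj hv'
  have hjb := (B.twoConnected.reachableIn hj hb hvj.ne.symm h.left_mem).mono (hsub _)
  have hbj' := (B'.twoConnected.reachableIn hb' hj' h.right_mem hvj'.ne.symm).mono (hsub _)
  obtain ⟨T, hT, hvT, hjT, hjT'⟩ :=
    exists_twoConnected_of_reachableIn_compl hvj hvj' ((hjb.trans h).trans hbj')
  obtain ⟨C, hC⟩ := exists_blockSet_of_twoConnected hT
  rw [BlockSet.eq_of_two_mem hvj.ne hv hj (hC hvT) (hC hjT),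
    BlockSet.eq_of_two_mem hvj'.ne hv' hj' (hC hvT) (hC hjT')]

/-- `p` can be reached from some vertex of `B` by a walk avoiding `v`. -/
def BlockSet.ReachesAvoiding (B : BlockSet Γ) (v p : V) : Prop :=
  ∃ b ∈ B.1, ReachableIn Γ {v}ᶜ b p

variable {B B' : BlockSet Γ} {v p q : V}

lemma BlockSet.ReachesAvoiding.ne (h : B.ReachesAvoiding v p) : p ≠ v := by
  obtain ⟨b, -, h⟩ := h
  exact h.right_mem

lemma BlockSet.ReachesAvoiding.trans (h : B.ReachesAvoiding v p) (hpq : ReachableIn Γ {v}ᶜ p q) :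
    B.ReachesAvoiding v q := by
  obtain ⟨b, hb, h⟩ := h
  exact ⟨b, hb, h.trans hpq⟩

lemma BlockSet.reachesAvoiding_of_mem (hp : p ∈ B.1) (hpv : p ≠ v) : B.ReachesAvoiding v p :=
  ⟨p, hp, .refl hpv⟩

lemma BlockSet.ReachesAvoiding.reachableIn (hp : B.ReachesAvoiding v p)
    (hq : B.ReachesAvoiding v q) : ReachableIn Γ {v}ᶜ p q := by
  obtain ⟨b, hb, h⟩ := hp
  obtain ⟨b', hb', h'⟩ := hq
  have hbb' := B.twoConnected.reachableIn hb hb' h.left_mem h'.left_mem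
  exact (h.symm.trans (hbb'.mono fun x hx => hx.2)).trans h'

lemma BlockSet.ReachesAvoiding.blockSet_eq [Finite V] (h : B.ReachesAvoiding v p)
    (h' : B'.ReachesAvoiding v p) (hv : v ∈ B.1) (hv' : v ∈ B'.1) : B = B' := by
  obtain ⟨b, hb, h⟩ := h
  obtain ⟨b', hb', h'⟩ := h'
  exact BlockSet.eq_of_reachableIn_compl hv hv' hb hb' (h.trans h'.symm)

lemma existsUnique_blockSet_reachesAvoiding [Finite V] (hΓ : Γ.Connected) (h : p ≠ v) :
    ∃! B : BlockSet Γ, v ∈ B.1 ∧ B.ReachesAvoiding v p := by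
  obtain ⟨P, hP⟩ := hΓ.exists_isPath v p
  cases P with
  | nil => exact absurd rfl h
  | @cons _ j _ hadj P' =>
    obtain ⟨B, hvB, hjB⟩ := exists_blockSet_of_adj hadj
    have hB : B.ReachesAvoiding v p :=
      ⟨j, hjB, reachableIn_compl_of_isPath hP (by simp) hadj.ne.symm⟩
    exact ⟨B, ⟨hvB, hB⟩, fun B' hB' => hB'.2.blockSet_eq hB hB'.1 hvB⟩

lemma card_connectedComponent_compl_singleton [Finite V] (hΓ : Γ.Connected) (j : V) :
    Nat.card (Γ.induce {j}ᶜ).ConnectedComponent = Nat.card {B : BlockSet Γ // j ∈ B.1} := by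
  choose f hjf hf using fun p : ({j}ᶜ : Set V) =>
    (existsUnique_blockSet_reachesAvoiding hΓ p.2).exists
  let block (p : ({j}ᶜ : Set V)) : {B : BlockSet Γ // j ∈ B.1} := ⟨f p, hjf p⟩
  have block_eq_iff (p q) : block p = block q ↔ (Γ.induce {j}ᶜ).Reachable p q := by
    rw [← reachableIn_iff_reachable_induce p.2 q.2]
    refine ⟨fun h => ?_, fun h => Subtype.ext ?_⟩
    · have hpq : f p = f q := Subtype.ext_iff.mp h
      exact (hf p).reachableIn (hpq ▸ hf q)
    · exact ((hf p).trans h).blockSet_eq (hf q) (hjf p) (hjf q)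
  refine Nat.card_eq_of_bijective (SimpleGraph.ConnectedComponent.lift block fun p q W _ =>
    (block_eq_iff p q).mpr ⟨W⟩) ⟨?_, ?_⟩
  · refine SimpleGraph.ConnectedComponent.ind₂ fun p q h => ?_
    exact SimpleGraph.ConnectedComponent.sound ((block_eq_iff p q).mp h)
  · rintro ⟨B, hB⟩
    obtain ⟨b, hb, hbj⟩ := B.twoConnected.exists_ne j
    exact ⟨(Γ.induce {j}ᶜ).connectedComponentMk ⟨b, hbj⟩, Subtype.ext
      ((hf ⟨b, hbj⟩).blockSet_eq (BlockSet.reachesAvoiding_of_mem hb hbj) (hjf _) hB)⟩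

end BlockSet

/-! ### Gates -/

section Gate

variable {V : Type*} {Γ : SimpleGraph V} [Finite V]

lemma BlockSet.reachesAvoiding_iff_of_adj {B : BlockSet Γ} {p q v : V} (hpq : Γ.Adj p q)
    (hB : ¬ (p ∈ B.1 ∧ q ∈ B.1)) (hv : v ∈ B.1) :
    B.ReachesAvoiding v p ↔ B.ReachesAvoiding v q := by
  suffices h : ∀ p q, Γ.Adj p q → ¬ (p ∈ B.1 ∧ q ∈ B.1) → B.ReachesAvoiding v p →
      B.ReachesAvoiding v q from
    ⟨h p q hpq hB, h q p hpq.symm fun h => hB h.symm⟩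
  intro p q hpq hB hp
  by_cases hqv : q = v
  · subst hqv
    obtain ⟨C, hpC, hqC⟩ := exists_blockSet_of_adj hpq
    have hBC : B = C :=
      hp.blockSet_eq (BlockSet.reachesAvoiding_of_mem hpC hpq.ne) hv hqC
    exact absurd ⟨hBC ▸ hpC, hv⟩ hB
  · exact hp.trans (.of_adj hpq hp.ne hqv)

lemma BlockSet.exists_reachesAvoiding_iff_ne (hΓ : Γ.Connected) (B : BlockSet Γ) (p : V) :
    ∃ x : B.1, ∀ v : B.1, B.ReachesAvoiding v p ↔ v ≠ x := by
  have of_mem (b : B.1) : ∀ v : B.1, B.ReachesAvoiding v b ↔ v ≠ b := fun v =>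
    ⟨fun h e => h.ne (congrArg Subtype.val e.symm),
      fun h => BlockSet.reachesAvoiding_of_mem b.2 fun e => h (Subtype.ext e.symm)⟩
  obtain ⟨b⟩ := B.twoConnected.1.nonempty
  have hbp := (SimpleGraph.reachable_iff_reflTransGen b.1 p).mp (hΓ.preconnected _ _)
  induction hbp with
  | refl => exact ⟨b, of_mem b⟩
  | @tail x y _ hxy ih =>
    by_cases hB : x ∈ B.1 ∧ y ∈ B.1
    · exact ⟨⟨y, hB.2⟩, of_mem ⟨y, hB.2⟩⟩
    · obtain ⟨u, hu⟩ := ih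
      exact ⟨u, fun v => (BlockSet.reachesAvoiding_iff_of_adj hxy hB v.2).symm.trans (hu v)⟩

/-- The gate of `p` in the block `B`: the vertex of `B` through which every walk from `p` to `B`
enters `B`. -/
noncomputable def gate (hΓ : Γ.Connected) (B : BlockSet Γ) (p : V) : B.1 :=
  (B.exists_reachesAvoiding_iff_ne hΓ p).choose

variable (hΓ : Γ.Connected) (B : BlockSet Γ)

lemma reachesAvoiding_iff_gate_ne (v : B.1) (p : V) :
    B.ReachesAvoiding v p ↔ gate hΓ B p ≠ v :=
  ((B.exists_reachesAvoiding_iff_ne hΓ p).choose_spec v).trans ne_comm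

lemma gate_of_mem (x : B.1) : gate hΓ B x = x :=
  of_not_not fun h => ((reachesAvoiding_iff_gate_ne hΓ B x x).mpr h).ne rfl

lemma gate_surjective : Function.Surjective (gate hΓ B) :=
  fun x => ⟨x, gate_of_mem hΓ B x⟩

lemma gate_eq_of_adj {p q : V} (hpq : Γ.Adj p q) (hB : ¬ (p ∈ B.1 ∧ q ∈ B.1)) :
    gate hΓ B p = gate hΓ B q := by
  have h := BlockSet.reachesAvoiding_iff_of_adj hpq hB (gate hΓ B q).2
  rw [reachesAvoiding_iff_gate_ne hΓ, reachesAvoiding_iff_gate_ne hΓ] at h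
  exact not_not.mp (mt h.mp (not_not.mpr rfl))

lemma gate_eq_of_mem_of_ne {B' : BlockSet Γ} (hne : B ≠ B') {p q : V} (hp : p ∈ B'.1)
    (hq : q ∈ B'.1) : gate hΓ B p = gate hΓ B q := by
  have h := (reachableIn_of_induce_connected B'.twoConnected.1 hp hq).reflTransGen
  induction h with
  | refl => rfl
  | @tail x y _ hxy ih =>
    obtain ⟨hadj, hx, hy⟩ := hxy
    exact (ih hx).trans (gate_eq_of_adj hΓ B hadj fun h =>
      hne (BlockSet.eq_of_two_mem hadj.ne h.1 h.2 hx hy))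

lemma reachableIn_gate_eq (p : V) :
    ReachableIn Γ {q | gate hΓ B q = gate hΓ B p} (gate hΓ B p) p := by
  have hp : ¬ B.ReachesAvoiding (gate hΓ B p) p := by
    simp [reachesAvoiding_iff_gate_ne hΓ]
  obtain ⟨P, hP⟩ := hΓ.exists_isPath (gate hΓ B p).1 p
  refine ⟨P, fun x hx => of_not_not fun h => hp ?_⟩
  have hx' := (reachesAvoiding_iff_gate_ne hΓ B _ x).mpr h
  exact hx'.trans (reachableIn_compl_of_isPath hP hx hx'.ne)

lemma reachableIn_gate_ne {x : B.1} {p q : V} (hp : gate hΓ B p ≠ x) (hq : gate hΓ B q ≠ x) :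
    ReachableIn Γ {r | gate hΓ B r ≠ x} p q := by
  classical
  simp only [← reachesAvoiding_iff_gate_ne hΓ] at hp hq ⊢
  obtain ⟨W, hW⟩ := hp.reachableIn hq
  exact ⟨W, fun r hr => hp.trans ⟨W.takeUntil r hr, fun z hz =>
    hW z (W.support_takeUntil_subset_support hr hz)⟩⟩

lemma reflTransGen_adj_and_gate_eq_iff {x : B.1} {p q : V}
    (hpq : gate hΓ B p = x ↔ gate hΓ B q = x) :
    Relation.ReflTransGen (fun i j => Γ.Adj i j ∧ (gate hΓ B i = x ↔ gate hΓ B j = x)) p q := by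
  by_cases hp : gate hΓ B p = x
  · have hpx := reachableIn_gate_eq hΓ B p
    have hqx := reachableIn_gate_eq hΓ B q
    rw [hp] at hpx
    rw [hpq.mp hp] at hqx
    exact Relation.ReflTransGen.mono (fun i j h => ⟨h.1, iff_of_true h.2.1 h.2.2⟩) _ _
      (hpx.symm.trans hqx).reflTransGen
  · exact Relation.ReflTransGen.mono (fun i j h => ⟨h.1, iff_of_false h.2.1 h.2.2⟩) _ _
      (reachableIn_gate_ne hΓ B hp (mt hpq.mpr hp)).reflTransGen

open scoped Classical in
lemma card_filter_gate_eq_add (i k : V) :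
    #{B : BlockSet Γ | (gate hΓ B k : V) = i} + (if k = i then 0 else 1) =
      #{B : BlockSet Γ | i ∈ B.1} := by
  have hsplit : #{B : BlockSet Γ | (gate hΓ B k : V) = i} +
      #{B : BlockSet Γ | i ∈ B.1 ∧ B.ReachesAvoiding i k} = #{B : BlockSet Γ | i ∈ B.1} := by
    rw [← card_filter_add_card_filter_not (s := {B : BlockSet Γ | i ∈ B.1})
      fun B => (gate hΓ B k : V) = i, filter_filter, filter_filter]
    congr 2 <;> ext B <;> simp only [mem_filter, mem_univ, true_and]
    · exact ⟨fun h => ⟨h ▸ (gate hΓ B k).2, h⟩, And.right⟩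
    · refine and_congr_right fun hi => ?_
      rw [reachesAvoiding_iff_gate_ne hΓ B ⟨i, hi⟩, Ne, Subtype.ext_iff]
  rw [← hsplit]
  congr 1
  split_ifs with h
  · exact (card_eq_zero.mpr (filter_eq_empty_iff.mpr fun B _ hB => hB.2.ne h)).symm
  · obtain ⟨B, hB, huniq⟩ := existsUnique_blockSet_reachesAvoiding hΓ h
    exact (card_eq_one.mpr ⟨B, by ext C; simpa using ⟨huniq C, fun e => e ▸ hB⟩⟩).symm

end Gate

open scoped Classical in
lemma sum_card_filter_mem_add_one {V : Type*} [Fintype V] {Γ : SimpleGraph V} (hΓ : Γ.Connected) :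
    ∑ i, #{B : BlockSet Γ | i ∈ B.1} + 1 = Fintype.card V + Fintype.card (BlockSet Γ) := by
  obtain ⟨k⟩ := hΓ.nonempty
  have hgate : ∑ i, #{B : BlockSet Γ | (gate hΓ B k : V) = i} = Fintype.card (BlockSet Γ) := by
    rw [← card_univ, card_eq_sum_card_fiberwise (f := fun B => (gate hΓ B k : V)) (t := univ)
      fun B _ => mem_coe.mpr (mem_univ _)]
  have hne : ∑ i, (if k = i then 0 else 1) + 1 = Fintype.card V := by
    rw [← card_univ, ← card_erase_add_one (mem_univ k), ← filter_ne]
    simp only [card_filter, ite_not]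
  simp only [← card_filter_gate_eq_add hΓ _ k, sum_add_distrib, hgate]
  omega

/-! ### Functions of a permutation invariant under transpositions -/

section Invariance

variable {G V K : Type*} [CommRing K]

lemma exists_perm_apply_eq_and_apply_eq {a b a' b' : V} (hab : a ≠ b) (hab' : a' ≠ b') :
    ∃ w : Perm V, w a = a' ∧ w b = b' :=
  (MulAction.is_two_pretransitive_iff (G := Perm V)).mp (isMultiplyPretransitive V 2) hab hab'

lemma mem_of_forall_swap_mem [Finite V] [DecidableEq V] {H : Subgroup (Perm V)} {π : Perm V}
    (h : ∀ x, swap x (π x) ∈ H) : π ∈ H := by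
  let S : Set (Perm V) := {σ | σ ∈ H ∧ σ.IsSwap}
  suffices π ∈ Subgroup.closure S from
    (Subgroup.closure_le H).mpr (fun σ (hσ : σ ∈ S) => hσ.1) this
  refine (mem_closure_isSwap fun σ (hσ : σ ∈ S) => hσ.2).mpr ⟨Set.toFinite _, fun x => ?_⟩
  by_cases hx : x = π x
  · rw [← hx]
    exact MulAction.mem_orbit_self x
  · exact ⟨⟨swap x (π x), Subgroup.subset_closure ⟨h x, x, π x, hx, rfl⟩⟩, swap_apply_left x (π x)⟩

/-- The subgroup of right periods of a function `f` on a group. -/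
def rightPeriods [Group G] (f : G → K) : Subgroup G where
  carrier := {π | ∀ w, f (w * π) = f w}
  one_mem' w := by rw [mul_one]
  mul_mem' {π σ} hπ hσ w := by rw [← mul_assoc, hσ, hπ]
  inv_mem' {π} hπ w := by rw [← hπ, inv_mul_cancel_right]

variable (K) in
/-- The space of functions on a group that are invariant under right translation by `H`. -/
def rightInvariant [Group G] (H : Subgroup G) : Submodule K (G → K) where
  carrier := {f | H ≤ rightPeriods f}
  zero_mem' _ _ _ := rfl
  add_mem' hf hg _ hπ w := congrArg₂ (· + ·) (hf hπ w) (hg hπ w)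
  smul_mem' c _ hf _ hπ w := congrArg (c * ·) (hf hπ w)

lemma finrank_rightInvariant [Nontrivial K] [Group G] [Finite G] (H : Subgroup G) :
    Module.finrank K (rightInvariant K H) = H.index := by
  have hrange : LinearMap.range (LinearMap.funLeft K K (QuotientGroup.mk : G → G ⧸ H)) =
      rightInvariant K H := by
    ext f
    constructor
    · rintro ⟨φ, rfl⟩ π hπ w
      exact congrArg φ (QuotientGroup.mk_mul_of_mem w hπ)
    · intro hf
      refine ⟨Quotient.lift f fun a b hab => ?_, rfl⟩
      simpa using (hf (QuotientGroup.leftRel_apply.mp hab) a).symm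
  have := Fintype.ofFinite (G ⧸ H)
  rw [← hrange, LinearMap.finrank_range_of_inj
    (LinearMap.funLeft_injective_of_surjective K K _ QuotientGroup.mk_surjective),
    Module.finrank_fintype_fun_eq_card, Subgroup.index, Nat.card_eq_fintype_card]

lemma finrank_rightInvariant_stabilizer [Nontrivial K] [Fintype V] (A : Finset V) :
    Module.finrank K (rightInvariant K (MulAction.stabilizer (Perm V) (A : Set V))) =
      (Fintype.card V).choose #A := by
  classical
  have : MulAction.IsPretransitive (Perm V) (Set.powersetCard V #A) :=
    Set.powersetCard.isPretransitive
  let s : Set.powersetCard V #A := ⟨A, rfl⟩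
  have hs : MulAction.stabilizer (Perm V) (A : Set V) = MulAction.stabilizer (Perm V) s :=
    (Set.powersetCard.stabilizer_coe s).symm
  rw [finrank_rightInvariant, hs, MulAction.index_stabilizer_of_transitive, Set.powersetCard.card,
    Nat.card_eq_fintype_card]

variable [DecidableEq V]

variable (K) in
/-- The space of functions of a permutation `w` that do not change when the values of `w` at `p`
and `q` are exchanged. -/
def swapInvariant (p q : V) : Submodule K (Perm V → K) where
  carrier := {f | swap p q ∈ rightPeriods f}
  zero_mem' _ := rfl
  add_mem' hf hg w := congrArg₂ (· + ·) (hf w) (hg w)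
  smul_mem' c _ hf w := congrArg (c * ·) (hf w)

lemma mem_swapInvariant_self (f : Perm V → K) (p : V) : f ∈ swapInvariant K p p :=
  fun w => by rw [swap_self]; rfl

lemma swapInvariant_comm (p q : V) : swapInvariant K p q = swapInvariant K q p := by
  simp only [swapInvariant, swap_comm]

lemma mem_swapInvariant_trans {f : Perm V → K} {p q r : V} (hpq : f ∈ swapInvariant K p q)
    (hqr : f ∈ swapInvariant K q r) : f ∈ swapInvariant K p r :=
  SubmonoidClass.swap_mem_trans (rightPeriods f) hpq hqr

lemma mem_swapInvariant_of_reflTransGen {f : Perm V → K} {r : V → V → Prop}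
    (h : ∀ p q, r p q → f ∈ swapInvariant K p q) {p q : V} (hpq : Relation.ReflTransGen r p q) :
    f ∈ swapInvariant K p q := by
  induction hpq with
  | refl => exact mem_swapInvariant_self f p
  | tail _ hqr ih => exact mem_swapInvariant_trans ih (h _ _ hqr)

lemma apply_mul_of_forall_mem_swapInvariant [Finite V] {f : Perm V → K} {π : Perm V}
    (h : ∀ x, f ∈ swapInvariant K x (π x)) (w : Perm V) : f (w * π) = f w :=
  mem_of_forall_swap_mem (H := rightPeriods f) h w

lemma apply_eq_apply_of_forall_mem_swapInvariant [Finite V] {f : Perm V → K} {w w' : Perm V}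
    (h : ∀ x y, w x = w' y → f ∈ swapInvariant K x y) : f w = f w' := by
  simpa using apply_mul_of_forall_mem_swapInvariant (f := f) (π := w'⁻¹ * w)
    (fun x => h x _ (by simp)) w'

lemma mem_rightInvariant_stabilizer_iff [Finite V] {A : Set V} {f : Perm V → K} :
    f ∈ rightInvariant K (MulAction.stabilizer (Perm V) A) ↔
      ∀ p q, (p ∈ A ↔ q ∈ A) → f ∈ swapInvariant K p q := by
  refine ⟨fun hf p q hpq => hf (swap_mem_stabilizer.mpr hpq), fun hf π hπ w => ?_⟩
  exact apply_mul_of_forall_mem_swapInvariant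
    (fun x => hf x (π x) (MulAction.mem_stabilizer_set.mp hπ x).symm) w

end Invariance

/-! ### Families indexed by the parts of a partition -/

section SwapDifference

variable {V K : Type*} [CommRing K] [DecidableEq V]

/-- The change of a function of a permutation `w` when the values of `w` at `p` and `q` are
exchanged. -/
def swapDifference (p q : V) (f : Perm V → K) : Perm V → K := fun w => f w - f (w * swap p q)

lemma swapDifference_comm (p q : V) (f : Perm V → K) :
    swapDifference p q f = swapDifference q p f := by
  funext w
  rw [swapDifference, swapDifference, swap_comm]

lemma swapDifference_mul_swap (p q : V) (f : Perm V → K) (w : Perm V) :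
    swapDifference p q f (w * swap p q) = -swapDifference p q f w := by
  simp only [swapDifference, mul_assoc, swap_mul_self, mul_one, neg_sub]

lemma swapDifference_mem_swapInvariant {p q a b : V} {f : Perm V → K}
    (hf : f ∈ swapInvariant K a b) (hap : a ≠ p) (haq : a ≠ q) (hbp : b ≠ p) (hbq : b ≠ q) :
    swapDifference p q f ∈ swapInvariant K a b := by
  intro w
  have hcomm : w * swap a b * swap p q = w * swap p q * swap a b := by
    rw [mul_assoc, mul_assoc, mul_swap_eq_swap_mul, swap_apply_of_ne_of_ne hap.symm hbp.symm,
      swap_apply_of_ne_of_ne haq.symm hbq.symm]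
  simp only [swapDifference, hcomm, hf w, hf (w * swap p q)]

lemma swapDifference_eq_swapDifference_mul_swap {p q r : V} {f : Perm V → K}
    (hf : f ∈ swapInvariant K q r) (hpq : p ≠ q) (hpr : p ≠ r) (w : Perm V) :
    swapDifference p q f w = swapDifference p r f (w * swap q r) := by
  have hcomm : w * swap q r * swap p r = w * swap p q * swap q r := by
    rw [mul_assoc, mul_assoc, mul_swap_eq_swap_mul, swap_apply_of_ne_of_ne hpq hpr,
      swap_apply_right]
  simp only [swapDifference, hcomm, hf w, hf (w * swap p q)]

end SwapDifference

section PartitionForms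

variable {V β K : Type*} [CommRing K] [DecidableEq V] [Fintype β]

variable (K) in
/-- Families `F`, indexed by the parts of the partition of `V` into the fibres of `g`, of functions
of a permutation `w` such that `F x` depends only on the image under `w` of the part `x` and such
that the members of the family add up to zero. -/
def partitionForms (g : V → β) : Submodule K (β → Perm V → K) where
  carrier := {F | (∀ x p q, (g p = x ↔ g q = x) → F x ∈ swapInvariant K p q) ∧ ∑ x, F x = 0}
  zero_mem' := ⟨fun _ _ _ _ => zero_mem _, Finset.sum_const_zero⟩
  add_mem' hF hF' := ⟨fun x p q h => add_mem (hF.1 x p q h) (hF'.1 x p q h), by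
    simp only [Pi.add_apply, sum_add_distrib, hF.2, hF'.2, add_zero]⟩
  smul_mem' c F hF := ⟨fun x p q h => Submodule.smul_mem _ c (hF.1 x p q h), by
    simp only [Pi.smul_apply, ← smul_sum, hF.2, smul_zero]⟩

variable {g : V → β} {F : β → Perm V → K}

lemma sum_mem_swapInvariant_of_mem_partitionForms (hF : F ∈ partitionForms K g) {s : Finset β}
    {p q : V} (hs : g p ∈ s ↔ g q ∈ s) : ∑ x ∈ s, F x ∈ swapInvariant K p q := by
  classical
  have hout : ∀ t : Finset β, g p ∉ t → g q ∉ t → ∑ x ∈ t, F x ∈ swapInvariant K p q :=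
    fun t hp hq => sum_mem fun x hx => hF.1 x p q
      (iff_of_false (fun h => hp (h ▸ hx)) fun h => hq (h ▸ hx))
  by_cases hp : g p ∈ s
  · have hsum := Finset.sum_add_sum_compl s F
    rw [hF.2] at hsum
    rw [eq_neg_of_add_eq_zero_left hsum]
    exact neg_mem (hout sᶜ (by simpa using hp) (by simpa using hs.mp hp))
  · exact hout s hp (mt hs.mpr hp)

lemma finrank_partitionForms_of_card_eq_two [Nontrivial K] [Fintype V] [DecidableEq β]
    (hβ : Fintype.card β = 2) (g : V → β) (x : β) :
    Module.finrank K (partitionForms K g) = (Fintype.card V).choose #{v | g v = x} := by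
  obtain ⟨y, hyx⟩ := Fintype.exists_ne_of_one_lt_card (by omega) x
  have hxy : ({x, y} : Finset β) = univ :=
    eq_univ_of_card _ (by rw [card_pair hyx.symm, hβ])
  have hsum (F : β → Perm V → K) : ∑ z, F z = F x + F y := by rw [← hxy, sum_pair hyx.symm]
  have hcase (z : β) : z = x ∨ z = y := by
    have hz : z ∈ ({x, y} : Finset β) := hxy ▸ mem_univ z
    simpa using hz
  have hiff (p : V) : g p = y ↔ ¬ g p = x := by
    rcases hcase (g p) with h | h <;> simp [h, hyx, hyx.symm]
  have hmem (f : Perm V → K) :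
      f ∈ rightInvariant K (MulAction.stabilizer (Perm V) (({v | g v = x} : Finset V) : Set V)) ↔
        ∀ p q, (g p = x ↔ g q = x) → f ∈ swapInvariant K p q := by
    simp only [mem_rightInvariant_stabilizer_iff, coe_filter, mem_univ, true_and, Set.mem_ofPred_eq]
  rw [← finrank_rightInvariant_stabilizer (K := K)]
  let memberAt := (LinearMap.proj x).restrict fun F (hF : F ∈ partitionForms K g) =>
    (hmem (F x)).mpr (hF.1 x)
  refine (LinearEquiv.ofBijective memberAt ⟨fun F F' hFF' => ?_, fun f => ?_⟩).finrank_eq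
  · have hx : F.1 x = F'.1 x := congrArg Subtype.val hFF'
    have hy : F.1 y = F'.1 y := by
      rw [eq_neg_of_add_eq_zero_right ((hsum F.1).symm.trans F.2.2), hx,
        ← eq_neg_of_add_eq_zero_right ((hsum F'.1).symm.trans F'.2.2)]
    exact Subtype.ext (funext fun z => (hcase z).elim (fun h => h ▸ hx) fun h => h ▸ hy)
  · have hf := (hmem f.1).mp f.2
    refine ⟨⟨fun z => if z = x then f.1 else -f.1, fun z p q hpq => ?_, ?_⟩, ?_⟩
    · rcases hcase z with rfl | rfl
      · simpa using hf p q hpq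
      · simpa [hyx] using hf p q (not_iff_not.mp (by rwa [hiff, hiff] at hpq))
    · simp [hsum, hyx]
    · exact Subtype.ext (if_pos rfl)

lemma swapDifference_eq_neg_swapDifference (hF : F ∈ partitionForms K g) {p q : V}
    (hpq : g p ≠ g q) (w : Perm V) :
    swapDifference p q (F (g p)) w = -swapDifference q p (F (g q)) w := by
  classical
  have h := sum_mem_swapInvariant_of_mem_partitionForms hF (s := {g p, g q}) (p := p) (q := q)
    (by simp) w
  simp only [sum_pair hpq, Pi.add_apply] at h
  simp only [swapDifference, swap_comm q p]
  linear_combination -h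

lemma exists_swapDifference_eq_of_places [Finite V] (h3 : ∀ x y, ∃ v, g v ≠ x ∧ g v ≠ y)
    (hF : F ∈ partitionForms K g) {p q : V} (hpq : g p ≠ g q) :
    ∃ δ : V → V → K, ∀ w, swapDifference p q (F (g p)) w = δ (w p) (w q) := by
  let D := swapDifference p q (F (g p))
  have hneg : D = -swapDifference p q (F (g q)) := funext fun w => by
    rw [Pi.neg_apply, swapDifference_comm p q (F (g q))]
    exact swapDifference_eq_neg_swapDifference hF hpq w
  obtain ⟨r, hrp, hrq⟩ := h3 (g p) (g q)
  have ne_of_ne {a b : V} (h : g a ≠ g b) : a ≠ b := fun e => h (congrArg g e)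
  have hr (a : V) (hap : a ≠ p) (haq : a ≠ q) : D ∈ swapInvariant K a r := by
    by_cases ha : g a = g p
    · rw [hneg]
      exact neg_mem (swapDifference_mem_swapInvariant
        (hF.1 _ _ _ (iff_of_false (ha ▸ hpq) hrq)) hap haq (ne_of_ne hrp) (ne_of_ne hrq))
    · exact swapDifference_mem_swapInvariant
        (hF.1 _ _ _ (iff_of_false ha hrp)) hap haq (ne_of_ne hrp) (ne_of_ne hrq)
  have hfactors : D.FactorsThrough fun w => (w p, w q) := by
    intro w w' hww'
    obtain ⟨hp, hq⟩ := Prod.mk_inj.mp hww'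
    refine apply_eq_apply_of_forall_mem_swapInvariant fun a b hab => ?_
    have ha_iff (c : V) (hc : w c = w' c) : a = c ↔ b = c := by
      rw [← w.injective.eq_iff, hab, hc, w'.injective.eq_iff]
    by_cases hap : a = p
    · rw [hap, (ha_iff p hp).mp hap]
      exact mem_swapInvariant_self D p
    by_cases haq : a = q
    · rw [haq, (ha_iff q hq).mp haq]
      exact mem_swapInvariant_self D q
    · refine mem_swapInvariant_trans (hr a hap haq) ?_
      rw [swapInvariant_comm]
      exact hr b (mt (ha_iff p hp).mpr hap) (mt (ha_iff q hq).mpr haq)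
  exact ⟨fun a b => Function.extend (fun w : Perm V => (w p, w q)) D 0 (a, b),
    fun w => (hfactors.extend_apply 0 w).symm⟩

lemma exists_swapDifference_eq [Finite V] (h3 : ∀ x y, ∃ v, g v ≠ x ∧ g v ≠ y)
    (hF : F ∈ partitionForms K g) :
    ∃ δ : V → V → K, ∀ p q, g p ≠ g q →
      ∀ w, swapDifference p q (F (g p)) w = δ (w p) (w q) := by
  have hplaces (p q : V) : ∃ δ : V → V → K, g p ≠ g q →
      ∀ w, swapDifference p q (F (g p)) w = δ (w p) (w q) := by
    by_cases hpq : g p = g q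
    · exact ⟨0, fun h => absurd hpq h⟩
    · exact (exists_swapDifference_eq_of_places h3 hF hpq).imp fun δ hδ _ => hδ
  choose δ hδ using hplaces
  have ne_of_ne {a b : V} (h : g a ≠ g b) : a ≠ b := fun e => h (congrArg g e)
  have hright {p q r a b : V} (hpq : g p ≠ g q) (hpr : g p ≠ g r) (hab : a ≠ b) :
      δ p q a b = δ p r a b := by
    obtain ⟨w, rfl, rfl⟩ := exists_perm_apply_eq_and_apply_eq (ne_of_ne hpq) hab
    rw [← hδ p q hpq, swapDifference_eq_swapDifference_mul_swap
      (hF.1 _ q r (iff_of_false hpq.symm hpr.symm)) (ne_of_ne hpq) (ne_of_ne hpr), hδ p r hpr]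
    simp [swap_apply_of_ne_of_ne (ne_of_ne hpq) (ne_of_ne hpr)]
  have hflip {p q a b : V} (hpq : g p ≠ g q) (hab : a ≠ b) : δ p q a b = -δ q p b a := by
    obtain ⟨w, rfl, rfl⟩ := exists_perm_apply_eq_and_apply_eq (ne_of_ne hpq) hab
    rw [← hδ p q hpq, ← hδ q p hpq.symm, swapDifference_eq_neg_swapDifference hF hpq]
  have hleft {p q r a b : V} (hpq : g p ≠ g q) (hrq : g r ≠ g q) (hab : a ≠ b) :
      δ p q a b = δ r q a b := by
    rw [hflip hpq hab, hright hpq.symm hrq.symm hab.symm, ← hflip hrq hab]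
  by_cases hg : ∃ p₀ q₀, g p₀ ≠ g q₀
  · obtain ⟨p₀, q₀, h₀⟩ := hg
    refine ⟨δ p₀ q₀, fun p q hpq w => ?_⟩
    obtain ⟨r, hrq, hrq₀⟩ := h3 (g q) (g q₀)
    have hw : w p ≠ w q := w.injective.ne (ne_of_ne hpq)
    rw [hδ p q hpq, hleft hpq hrq hw, hright hrq hrq₀ hw, hleft hrq₀ h₀ hw]
  · push Not at hg
    exact ⟨0, fun p q hpq => absurd (hg p q) hpq⟩

lemma swapDifference_add_swapDifference (hF : F ∈ partitionForms K g) {p q r : V}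
    (hpq : g p ≠ g q) (hpr : g p ≠ g r) (hqr : q ≠ r) (w : Perm V) :
    swapDifference p q (F (g p)) w + swapDifference p r (F (g p)) (w * swap p q) =
      swapDifference p r (F (g p)) w := by
  have hcomm : w * swap p q * swap p r = w * swap p r * swap r q := by
    rw [mul_assoc, mul_assoc, mul_swap_eq_swap_mul (swap p r), swap_apply_right,
      swap_apply_of_ne_of_ne (fun h => hpq (congrArg g h.symm)) hqr]
  simp only [swapDifference]
  rw [hcomm, hF.1 _ r q (iff_of_false hpr.symm hpq.symm), sub_add_sub_cancel]

lemma exists_swapDifference_eq_sub [Finite V] (h3 : ∀ x y, ∃ v, g v ≠ x ∧ g v ≠ y)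
    (hF : F ∈ partitionForms K g) :
    ∃ μ : V → K, ∀ p q, g p ≠ g q →
      ∀ w, swapDifference p q (F (g p)) w = μ (w p) - μ (w q) := by
  obtain ⟨δ, hδ⟩ := exists_swapDifference_eq h3 hF
  rcases isEmpty_or_nonempty V with hV | ⟨⟨p₀⟩⟩
  · exact ⟨0, fun p => hV.elim p⟩
  obtain ⟨q₀, hqp, -⟩ := h3 (g p₀) (g p₀)
  obtain ⟨r₀, hrp, hrq⟩ := h3 (g p₀) (g q₀)
  have ne_of_ne {a b : V} (h : g a ≠ g b) : a ≠ b := fun e => h (congrArg g e)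
  have hanti {a b : V} (hab : a ≠ b) : δ b a = -δ a b := by
    obtain ⟨w, rfl, rfl⟩ := exists_perm_apply_eq_and_apply_eq (ne_of_ne hqp.symm) hab
    rw [← hδ _ _ hqp.symm, ← swapDifference_mul_swap, hδ _ _ hqp.symm]
    simp
  have hcocycle {a b c : V} (hab : a ≠ b) (hac : a ≠ c) (hbc : b ≠ c) :
      δ a b + δ b c = δ a c := by
    obtain ⟨w, hw⟩ := exists_extending_pair ![p₀, q₀, r₀] ![a, b, c]
      (by simp [Function.Injective, Fin.forall_fin_succ, ne_of_ne hqp, ne_of_ne hqp.symm,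
        ne_of_ne hrp, ne_of_ne hrp.symm, ne_of_ne hrq, ne_of_ne hrq.symm])
      (by simp [Function.Injective, Fin.forall_fin_succ, hab, hab.symm, hac, hac.symm, hbc,
        hbc.symm])
    obtain ⟨rfl, rfl, rfl⟩ : w p₀ = a ∧ w q₀ = b ∧ w r₀ = c := ⟨hw 0, hw 1, hw 2⟩
    have hsum := swapDifference_add_swapDifference hF hqp.symm hrp.symm (ne_of_ne hrq).symm w
    rwa [hδ _ _ hqp.symm, hδ _ _ hrp.symm, hδ _ _ hrp.symm, mul_apply, mul_apply, swap_apply_left,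
      swap_apply_of_ne_of_ne (ne_of_ne hrp) (ne_of_ne hrq)] at hsum
  classical
  refine ⟨fun a => if a = p₀ then 0 else δ a p₀, fun p q hpq w => ?_⟩
  have hw : w p ≠ w q := w.injective.ne (ne_of_ne hpq)
  rw [hδ p q hpq]
  beta_reduce
  split_ifs with hp hq hq
  · exact absurd (hp.trans hq.symm) hw
  · rw [hp, hanti hq, zero_sub]
  · rw [hq, sub_zero]
  · rw [← hcocycle hw hp hq, add_sub_cancel_right]

end PartitionForms

section AffineFamilies

variable {V β K : Type*} [CommRing K] [Fintype V] [DecidableEq β] {g : V → β}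

/-- The sum of `μ` over the image under `w` of the fibre of `g` over `x`. -/
def fiberSum (g : V → β) (μ : V → K) (x : β) (w : Perm V) : K := ∑ p with g p = x, μ (w p)

variable (g) in
/-- The family whose member at `x` is the constant `c x` plus the sum of `μ` over the image of the
part `x`, as a function of the pair `(c, μ)`. -/
def affineFamily : (β → K) × (V → K) →ₗ[K] (β → Perm V → K) where
  toFun y x w := y.1 x + fiberSum g y.2 x w
  map_add' y z := by
    ext x w
    simp only [fiberSum, Prod.fst_add, Prod.snd_add, Pi.add_apply, sum_add_distrib]
    ring
  map_smul' c y := by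
    ext x w
    simp only [fiberSum, Prod.smul_fst, Prod.smul_snd, Pi.smul_apply, smul_eq_mul, mul_add,
      Finset.mul_sum, RingHom.id_apply]

section SwapInvariance

variable [DecidableEq V]

lemma fiberSum_mem_swapInvariant (μ : V → K) {x : β} {p q : V} (h : g p = x ↔ g q = x) :
    fiberSum g μ x ∈ swapInvariant K p q := by
  intro w
  refine Finset.sum_equiv (swap p q) (fun v => ?_) fun v _ => rfl
  simp only [mem_filter, mem_univ, true_and, swap_apply_def]
  split_ifs with hp hq
  · rw [hp, h]
  · rw [hq, h]
  · rfl

lemma swapDifference_fiberSum (μ : V → K) {p q : V} (hpq : g p ≠ g q) (w : Perm V) :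
    swapDifference p q (fiberSum g μ (g p)) w = μ (w p) - μ (w q) := by
  rw [swapDifference, fiberSum, fiberSum, ← Finset.sum_sub_distrib, Finset.sum_eq_single p]
  · rw [mul_apply, swap_apply_left]
  · intro v hv hvp
    have hvq : v ≠ q := fun h => hpq (h ▸ (mem_filter.mp hv).2.symm)
    rw [mul_apply, swap_apply_of_ne_of_ne hvp hvq, sub_self]
  · exact fun hp => absurd (by simp) hp

lemma affineFamily_mem_swapInvariant (y : (β → K) × (V → K)) {x : β} {p q : V}
    (h : g p = x ↔ g q = x) : affineFamily g y x ∈ swapInvariant K p q :=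
  fun w => congrArg (y.1 x + ·) (fiberSum_mem_swapInvariant y.2 h w)

end SwapInvariance

lemma ker_affineFamily_eq_span {p q : V} (hpq : g p ≠ g q) :
    LinearMap.ker (affineFamily g) =
      Submodule.span K {((fun x => -(#{v | g v = x} : K)), fun _ => (1 : K))} := by
  classical
  apply le_antisymm
  · intro y hy
    have hzero (x : β) (w : Perm V) : y.1 x + fiberSum g y.2 x w = 0 :=
      congrFun (congrFun hy x) w
    have hconst (a b : V) : y.2 a = y.2 b := by
      by_cases hab : a = b
      · rw [hab]
      obtain ⟨w, rfl, rfl⟩ := exists_perm_apply_eq_and_apply_eq (fun h => hpq (congrArg g h)) hab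
      have h := swapDifference_fiberSum y.2 hpq w
      rw [swapDifference] at h
      linear_combination -h + hzero (g p) w - hzero (g p) (w * swap p q)
    refine Submodule.mem_span_singleton.mpr ⟨y.2 p, Prod.ext (funext fun x => ?_) ?_⟩
    · have hx := hzero x 1
      simp only [fiberSum, hconst _ p, sum_const, nsmul_eq_mul] at hx
      simp only [Prod.smul_mk, Pi.smul_apply, smul_eq_mul]
      linear_combination -hx
    · exact funext fun a => (mul_one _).trans (hconst p a)
  · rw [Submodule.span_singleton_le_iff_mem, LinearMap.mem_ker]
    ext x w
    simp [affineFamily, fiberSum]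

variable [Fintype β]

lemma sum_fiberSum (g : V → β) (μ : V → K) (w : Perm V) :
    ∑ x, fiberSum g μ x w = ∑ a, μ a :=
  (Finset.sum_fiberwise univ g fun p => μ (w p)).trans (Equiv.sum_comp w μ)

variable (V β K) in
/-- The total of a pair of functions, which is the sum of the affine family of the pair. -/
def total : Module.Dual K ((β → K) × (V → K)) :=
  (∑ x, LinearMap.proj x).coprod (∑ a, LinearMap.proj a)

lemma sum_affineFamily_apply (y : (β → K) × (V → K)) (w : Perm V) :
    ∑ x, affineFamily g y x w = total V β K y := by
  simp only [affineFamily, LinearMap.coe_mk, AddHom.coe_mk, sum_add_distrib, sum_fiberSum, total,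
    LinearMap.coprod_apply, LinearMap.sum_apply, LinearMap.proj_apply]

variable [DecidableEq V]

lemma affineFamily_mem_partitionForms_iff {y : (β → K) × (V → K)} :
    affineFamily g y ∈ partitionForms K g ↔ y ∈ LinearMap.ker (total V β K) := by
  have hsum : ∑ x, affineFamily g y x = fun _ => total V β K y :=
    funext fun w => (Finset.sum_apply w _ _).trans (sum_affineFamily_apply y w)
  refine ⟨fun h => ?_, fun h => ⟨fun x p q => affineFamily_mem_swapInvariant y, ?_⟩⟩
  · exact congrFun (hsum.symm.trans h.2) 1
  · rw [hsum, LinearMap.mem_ker.mp h]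
    rfl

lemma exists_affineFamily_eq (h3 : ∀ x y, ∃ v, g v ≠ x ∧ g v ≠ y) {F : β → Perm V → K}
    (hF : F ∈ partitionForms K g) : ∃ y, affineFamily g y = F := by
  obtain ⟨μ, hμ⟩ := exists_swapDifference_eq_sub h3 hF
  refine ⟨(fun x => F x 1 - fiberSum g μ x 1, μ), funext fun x => funext fun w => ?_⟩
  have hcross {p q : V} (hp : g p = x) (hq : g q ≠ x) :
      F x - fiberSum g μ x ∈ swapInvariant K p q := by
    subst hp
    intro v
    have h := (hμ p q hq.symm v).trans (swapDifference_fiberSum μ hq.symm v).symm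
    simp only [swapDifference] at h
    simp only [Pi.sub_apply]
    linear_combination -h
  have hinv (p q : V) : F x - fiberSum g μ x ∈ swapInvariant K p q := by
    by_cases hpq : g p = x ↔ g q = x
    · exact sub_mem (hF.1 x p q hpq) (fiberSum_mem_swapInvariant μ hpq)
    by_cases hp : g p = x
    · exact hcross hp fun hq => hpq (iff_of_true hp hq)
    · rw [swapInvariant_comm]
      exact hcross (by_contra fun hq => hpq (iff_of_false hp hq)) hp
  have h := apply_eq_apply_of_forall_mem_swapInvariant (w := w) (w' := 1) fun p q _ => hinv p q
  simp only [Pi.sub_apply] at h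
  change F x 1 - fiberSum g μ x 1 + fiberSum g μ x w = F x w
  linear_combination -h

lemma map_affineFamily_ker_total (h3 : ∀ x y, ∃ v, g v ≠ x ∧ g v ≠ y) :
    (LinearMap.ker (total V β K)).map (affineFamily g) = partitionForms K g := by
  apply le_antisymm
  · rintro _ ⟨y, hy, rfl⟩
    exact affineFamily_mem_partitionForms_iff.mpr hy
  · intro F hF
    obtain ⟨y, rfl⟩ := exists_affineFamily_eq h3 hF
    exact ⟨y, affineFamily_mem_partitionForms_iff.mp hF, rfl⟩

end AffineFamilies

lemma finrank_partitionForms_of_three_le_card {V β K : Type*} [Field K] [Fintype V]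
    [DecidableEq V] [Fintype β] {g : V → β} (hg : Function.Surjective g)
    (hβ : 3 ≤ Fintype.card β) :
    Module.finrank K (partitionForms K g) + 2 = Fintype.card V + Fintype.card β := by
  classical
  have h3 (x y : β) : ∃ v, g v ≠ x ∧ g v ≠ y := by
    obtain ⟨z, -, hz⟩ := exists_mem_notMem_of_card_lt_card
      (show #({x, y} : Finset β) < #univ from card_le_two.trans_lt hβ)
    obtain ⟨v, rfl⟩ := hg z
    exact ⟨v, by simpa using hz⟩
  obtain ⟨x⟩ : Nonempty β := Fintype.card_pos_iff.mp (by omega)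
  obtain ⟨p, -⟩ := h3 x x
  obtain ⟨q, hqp, -⟩ := h3 (g p) (g p)
  have htotal : total V β K ≠ 0 := fun h => by
    have h1 : total V β K (Pi.single x 1, 0) = 0 := by rw [h, LinearMap.zero_apply]
    simp [total] at h1
  have hker_le : LinearMap.ker (affineFamily g) ≤ LinearMap.ker (total V β K) := fun y hy =>
    affineFamily_mem_partitionForms_iff.mp (hy.symm ▸ zero_mem (partitionForms K g))
  have hker : Module.finrank K (LinearMap.ker (affineFamily g : _ →ₗ[K] _)) = 1 := by
    rw [ker_affineFamily_eq_span hqp.symm]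
    exact finrank_span_singleton fun h => one_ne_zero (congrFun (congrArg Prod.snd h) p)
  have hdim := Module.Dual.finrank_ker_add_one_of_ne_zero htotal
  rw [Module.finrank_prod, Module.finrank_fintype_fun_eq_card,
    Module.finrank_fintype_fun_eq_card] at hdim
  have hrank := LinearMap.finrank_range_add_finrank_ker
    ((affineFamily g).domRestrict (LinearMap.ker (total V β K)))
  rw [LinearMap.range_domRestrict, map_affineFamily_ker_total h3, LinearMap.ker_domRestrict,
    (Submodule.comapSubtypeEquivOfLe hker_le).finrank_eq, hker] at hrank
  omega

/-! ### Coefficient families of linear splines -/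

section EdgeForms

variable {V K : Type*} [CommRing K] [DecidableEq V] {Γ : SimpleGraph V}

variable (K) in
/-- The coefficient families of linear splines: `Φ v w` is the coefficient of `t_{w(v)}` in the
value of the spline at `w`. -/
def edgeForms (Γ : SimpleGraph V) : Submodule K (V → Perm V → K) where
  carrier := {Φ | ∀ i j, Γ.Adj i j →
    (∀ k, k ≠ i → k ≠ j → Φ k ∈ swapInvariant K i j) ∧ Φ i + Φ j ∈ swapInvariant K i j}
  zero_mem' := fun _ _ _ => ⟨fun _ _ _ => zero_mem _, add_mem (zero_mem _) (zero_mem _)⟩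
  add_mem' {Φ Φ'} h h' i j hij :=
    ⟨fun k hi hj => add_mem ((h i j hij).1 k hi hj) ((h' i j hij).1 k hi hj), by
      simpa only [Pi.add_apply, add_add_add_comm] using add_mem (h i j hij).2 (h' i j hij).2⟩
  smul_mem' c Φ h i j hij :=
    ⟨fun k hi hj => Submodule.smul_mem _ c ((h i j hij).1 k hi hj), by
      simpa only [Pi.smul_apply, smul_add] using Submodule.smul_mem _ c (h i j hij).2⟩

lemma sum_mem_swapInvariant_of_mem_edgeForms {Φ : V → Perm V → K} (hΦ : Φ ∈ edgeForms K Γ)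
    {i j : V} (hij : Γ.Adj i j) {s : Finset V} (hs : i ∈ s ↔ j ∈ s) :
    ∑ k ∈ s, Φ k ∈ swapInvariant K i j := by
  by_cases hi : i ∈ s
  · have hsub : {i, j} ⊆ s := insert_subset hi (singleton_subset_iff.mpr (hs.mp hi))
    rw [← sum_sdiff hsub, sum_pair hij.ne]
    refine add_mem (sum_mem fun k hk => ?_) (hΦ i j hij).2
    simp only [mem_sdiff, mem_insert, mem_singleton, not_or] at hk
    exact (hΦ i j hij).1 k hk.2.1 hk.2.2
  · exact sum_mem fun k hk => (hΦ i j hij).1 k (fun e => hi (e ▸ hk))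
      fun e => hi (hs.mpr (e ▸ hk))

variable [Fintype V]

variable (K) in
/-- The coefficient families of linear splines whose coefficients sum to zero. -/
def zeroSumForms (Γ : SimpleGraph V) : Submodule K (V → Perm V → K) where
  carrier := {Φ | Φ ∈ edgeForms K Γ ∧ ∑ v, Φ v = 0}
  zero_mem' := ⟨zero_mem _, by simp⟩
  add_mem' := by
    rintro Φ Φ' ⟨h, hsum⟩ ⟨h', hsum'⟩
    exact ⟨add_mem h h', by simp only [Pi.add_apply, sum_add_distrib, hsum, hsum', add_zero]⟩
  smul_mem' := by
    rintro c Φ ⟨h, hsum⟩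
    exact ⟨Submodule.smul_mem _ c h, by simp only [Pi.smul_apply, ← smul_sum, hsum, smul_zero]⟩

lemma sum_apply_eq_of_mem_edgeForms (hΓ : Γ.Connected) {Φ : V → Perm V → K}
    (hΦ : Φ ∈ edgeForms K Γ) (w w' : Perm V) : (∑ v, Φ v) w = (∑ v, Φ v) w' :=
  apply_eq_apply_of_forall_mem_swapInvariant fun x y _ => mem_swapInvariant_of_reflTransGen
    (fun _ _ hij => sum_mem_swapInvariant_of_mem_edgeForms hΦ hij (by simp))
    ((SimpleGraph.reachable_iff_reflTransGen x y).mp (hΓ.preconnected x y))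

lemma finrank_edgeForms {K : Type*} [Field K] (hΓ : Γ.Connected) :
    Module.finrank K (edgeForms K Γ) = Module.finrank K (zeroSumForms K Γ) + 1 := by
  let f : Module.Dual K (edgeForms K Γ) :=
    LinearMap.proj 1 ∘ₗ (∑ v, LinearMap.proj v) ∘ₗ (edgeForms K Γ).subtype
  have f_apply (Φ : edgeForms K Γ) : f Φ = (∑ v, Φ.1 v) 1 := by simp [f]
  obtain ⟨r⟩ := hΓ.nonempty
  have hr : (fun v _ => if v = r then 1 else 0 : V → Perm V → K) ∈ edgeForms K Γ :=
    fun i j _ => ⟨fun _ _ _ _ => rfl, fun _ => rfl⟩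
  have hf : f ≠ 0 := fun h => by simpa [f_apply] using LinearMap.congr_fun h ⟨_, hr⟩
  have hker : (LinearMap.ker f).map (edgeForms K Γ).subtype = zeroSumForms K Γ := by
    ext Φ
    constructor
    · rintro ⟨Φ, h, rfl⟩
      exact ⟨Φ.2, funext fun w =>
        (sum_apply_eq_of_mem_edgeForms hΓ Φ.2 w 1).trans ((f_apply Φ).symm.trans h)⟩
    · rintro ⟨h, hsum⟩
      exact ⟨⟨Φ, h⟩, (f_apply _).trans (congrFun hsum 1), rfl⟩
  rw [← Module.Dual.finrank_ker_add_one_of_ne_zero hf, ← hker, Submodule.finrank_map_subtype_eq]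

end EdgeForms

/-! ### Decomposition of coefficient families along the blocks -/

section BlockDecomposition

variable {V K : Type*} [CommRing K] [DecidableEq V] [Fintype V] {Γ : SimpleGraph V}
  (hΓ : Γ.Connected)

/-- The family obtained from `Φ` by adding up its members over the fibres of the gate map of the
block `B`. -/
noncomputable def gateSum (Φ : V → Perm V → K) (B : BlockSet Γ) (x : B.1) : Perm V → K :=
  ∑ k with gate hΓ B k = x, Φ k

/-- The family on all vertices obtained by extending families on the blocks by zero and adding
them up. -/
noncomputable def blockSum (F : ∀ B : BlockSet Γ, B.1 → Perm V → K) (i : V) : Perm V → K :=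
  ∑ B : BlockSet Γ, ∑ x : B.1 with x.1 = i, F B x

lemma sum_gateSum (Φ : V → Perm V → K) (B : BlockSet Γ) (s : Finset B.1) :
    ∑ x ∈ s, gateSum hΓ Φ B x = ∑ k with gate hΓ B k ∈ s, Φ k :=
  sum_fiberwise_eq_sum_filter _ _ _ _

lemma sum_blockSum (F : ∀ B : BlockSet Γ, B.1 → Perm V → K) (s : Finset V) :
    ∑ i ∈ s, blockSum F i = ∑ B : BlockSet Γ, ∑ x : B.1 with x.1 ∈ s, F B x :=
  sum_comm.trans (sum_congr rfl fun _ _ => sum_fiberwise_eq_sum_filter _ _ _ _)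

lemma gateSum_mem_partitionForms {Φ : V → Perm V → K} (hΦ : Φ ∈ zeroSumForms K Γ)
    (B : BlockSet Γ) : gateSum hΓ Φ B ∈ partitionForms K (gate hΓ B) :=
  ⟨fun _ _ _ hpq => mem_swapInvariant_of_reflTransGen
    (fun _ _ hij => sum_mem_swapInvariant_of_mem_edgeForms hΦ.1 hij.1 (by simpa using hij.2))
    (reflTransGen_adj_and_gate_eq_iff hΓ B hpq), by simpa [sum_gateSum] using hΦ.2⟩

lemma blockSum_mem_zeroSumForms {F : ∀ B : BlockSet Γ, B.1 → Perm V → K}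
    (hF : ∀ B, F B ∈ partitionForms K (gate hΓ B)) : blockSum F ∈ zeroSumForms K Γ := by
  have hinv {i j : V} (hij : Γ.Adj i j) (s : Finset V) (hs : i ∈ s ↔ j ∈ s) :
      ∑ k ∈ s, blockSum F k ∈ swapInvariant K i j := by
    rw [sum_blockSum]
    refine sum_mem fun B _ => sum_mem_swapInvariant_of_mem_partitionForms (hF B) ?_
    by_cases hB : i ∈ B.1 ∧ j ∈ B.1
    · simpa [gate_of_mem hΓ B ⟨i, hB.1⟩, gate_of_mem hΓ B ⟨j, hB.2⟩] using hs
    · rw [gate_eq_of_adj hΓ B hij hB]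
  refine ⟨fun i j hij => ⟨fun k hki hkj => ?_, ?_⟩, ?_⟩
  · simpa using hinv hij {k} (by simp [hki.symm, hkj.symm])
  · simpa [sum_pair hij.ne] using hinv hij {i, j} (by simp)
  · simpa [sum_blockSum] using sum_eq_zero fun B _ => (hF B).2

lemma blockSum_gateSum {Φ : V → Perm V → K} (hΦ : ∑ v, Φ v = 0) :
    blockSum (gateSum hΓ Φ) = Φ := by
  classical
  funext i
  calc blockSum (gateSum hΓ Φ) i
      = ∑ k, #{B : BlockSet Γ | (gate hΓ B k : V) = i} • Φ k := by
        simp only [blockSum, sum_gateSum, mem_filter, mem_univ, true_and]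
        simp only [sum_filter]
        rw [sum_comm]
        simp only [← sum_filter, sum_const]
    _ = ∑ k, (#{B : BlockSet Γ | i ∈ B.1} • Φ k - if k = i then 0 else Φ k) := by
        refine sum_congr rfl fun k _ => ?_
        rw [← card_filter_gate_eq_add hΓ i k, add_smul, eq_sub_iff_add_eq]
        split_ifs <;> simp <;> congr
    _ = Φ i := by
        rw [sum_sub_distrib, ← smul_sum, hΦ, smul_zero, zero_sub, neg_eq_iff_eq_neg]
        simp [sum_ite, filter_ne', hΦ]

lemma gateSum_blockSum {F : ∀ B : BlockSet Γ, B.1 → Perm V → K} (hF : ∀ B, ∑ x, F B x = 0) :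
    gateSum hΓ (blockSum F) = F := by
  funext B x
  rw [gateSum, sum_blockSum, sum_eq_single B]
  · simp only [mem_filter, mem_univ, true_and, gate_of_mem, filter_eq', sum_singleton, if_true]
  · intro B' _ hne
    obtain ⟨⟨b, hb⟩⟩ := B'.twoConnected.1.nonempty
    have hconst (y : B'.1) : gate hΓ B y = gate hΓ B b :=
      gate_eq_of_mem_of_ne hΓ B hne.symm y.2 hb
    by_cases hbx : gate hΓ B b = x <;> simp [hconst, hbx, hF B']
  · exact fun h => absurd (mem_univ B) h

/-- The decomposition of a coefficient family with vanishing sum into its contributions from the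
blocks. -/
noncomputable def zeroSumFormsEquiv :
    zeroSumForms K Γ ≃ₗ[K] ∀ B : BlockSet Γ, partitionForms K (gate hΓ B) where
  toFun Φ B := ⟨gateSum hΓ Φ.1 B, gateSum_mem_partitionForms hΓ Φ.2 B⟩
  map_add' _ _ := funext fun _ => Subtype.ext (funext fun _ => sum_add_distrib)
  map_smul' c Φ := funext fun B => Subtype.ext (funext fun x =>
    (smul_sum (r := c) (f := Φ.1) (s := {k | gate hΓ B k = x})).symm)
  invFun F := ⟨blockSum fun B => (F B).1, blockSum_mem_zeroSumForms hΓ fun B => (F B).2⟩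
  left_inv Φ := Subtype.ext (blockSum_gateSum hΓ Φ.2.2)
  right_inv F := funext fun B =>
    Subtype.ext (congrFun (gateSum_blockSum hΓ fun B => (F B).2.2) B)

lemma finrank_zeroSumForms {K : Type*} [Field K] :
    Module.finrank K (zeroSumForms K Γ) =
      ∑ B : BlockSet Γ, Module.finrank K (partitionForms K (gate hΓ B)) := by
  rw [(zeroSumFormsEquiv hΓ).finrank_eq, Module.finrank_pi_fintype]

end BlockDecomposition

/-! ### Linear splines -/

section LinearForms

open MvPolynomial

variable {σ R : Type*} [CommRing R]

/-- The coefficient of the variable `i` in a polynomial. -/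
noncomputable def linearCoeff (i : σ) : MvPolynomial σ R →ₗ[R] R :=
  lcoeff R (Finsupp.single i 1)

lemma eq_of_linearCoeff_eq {p q : MvPolynomial σ R} (hp : p.IsHomogeneous 1)
    (hq : q.IsHomogeneous 1) (h : ∀ i, linearCoeff i p = linearCoeff i q) : p = q := by
  ext m
  by_cases hm : m.degree = 1
  · obtain ⟨i, rfl⟩ := (Finsupp.sum_eq_one_iff m).mp hm
    exact h i
  · rw [hp.coeff_eq_zero hm, hq.coeff_eq_zero hm]

lemma isHomogeneous_C_mul_X_one (r : R) (i : σ) :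
    (C r * X i : MvPolynomial σ R).IsHomogeneous 1 := by
  simpa using (isHomogeneous_C σ r).mul (isHomogeneous_X R i)

lemma linearCoeff_mul_X [DecidableEq σ] (p : MvPolynomial σ R) (i j : σ) :
    linearCoeff j (p * X i) = if i = j then constantCoeff p else 0 := by
  rw [linearCoeff, lcoeff_apply, coeff_mul_X']
  by_cases h : i = j
  · subst h
    simp [constantCoeff_eq]
  · simp [h]

lemma linearCoeff_C_mul_X [DecidableEq σ] (r : R) (i j : σ) :
    linearCoeff j (C r * X i) = if i = j then r else 0 := by
  rw [linearCoeff_mul_X, constantCoeff_C]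

lemma linearCoeff_sum_mul_X {ι : Type*} [Fintype ι] (p : ι → MvPolynomial σ R) (π : ι ≃ σ)
    (k : ι) : linearCoeff (π k) (∑ i, p i * X (π i)) = constantCoeff (p k) := by
  classical simp [linearCoeff_mul_X]

lemma mem_span_X_sub_X_iff {q : MvPolynomial σ R} (hq : q.IsHomogeneous 1) {a b : σ}
    (hab : a ≠ b) : q ∈ Ideal.span {(X a - X b : MvPolynomial σ R)} ↔
      (∀ c, c ≠ a → c ≠ b → linearCoeff c q = 0) ∧ linearCoeff a q + linearCoeff b q = 0 := by
  classical
  rw [Ideal.mem_span_singleton']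
  constructor
  · rintro ⟨p, rfl⟩
    simp only [mul_sub, map_sub, linearCoeff_mul_X]
    exact ⟨fun c ha hb => by simp [ha.symm, hb.symm], by simp [hab, hab.symm]⟩
  · rintro ⟨h, hsum⟩
    refine ⟨C (linearCoeff a q), eq_of_linearCoeff_eq ?_ hq fun c => ?_⟩
    · rw [mul_sub]
      exact (isHomogeneous_C_mul_X_one _ a).sub (isHomogeneous_C_mul_X_one _ b)
    · rw [mul_sub, map_sub, linearCoeff_C_mul_X, linearCoeff_C_mul_X]
      by_cases ha : a = c
      · subst ha
        simp [hab.symm]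
      by_cases hb : b = c
      · subst hb
        rw [if_neg ha, if_pos rfl, zero_sub, neg_eq_iff_add_eq_zero, hsum]
      · rw [if_neg ha, if_neg hb, h c (Ne.symm ha) (Ne.symm hb), sub_zero]

end LinearForms

section Splines

open MvPolynomial

variable {n : ℕ} {Γ : SimpleGraph (Fin n)}

/-- The coefficient family of a polynomial-valued function of a permutation; the coefficients are
read off in the variables `t_{w(v)}`, so that the spline `x̄ᵥ` has a constant family. -/
noncomputable def coeffFamily (ρ : Perm (Fin n) → MvPolynomial (Fin n) ℂ) :
    Fin n → Perm (Fin n) → ℂ :=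
  fun v w => linearCoeff (w v) (ρ w)

/-- The linear-form-valued function of a permutation with coefficient family `Φ`. -/
noncomputable def ofCoeffFamily (Φ : Fin n → Perm (Fin n) → ℂ) (w : Perm (Fin n)) :
    MvPolynomial (Fin n) ℂ :=
  ∑ v, C (Φ v w) * X (w v)

lemma ofCoeffFamily_isHomogeneous (Φ : Fin n → Perm (Fin n) → ℂ) (w : Perm (Fin n)) :
    (ofCoeffFamily Φ w).IsHomogeneous 1 :=
  IsHomogeneous.sum _ _ _ fun v _ => isHomogeneous_C_mul_X_one (Φ v w) (w v)

lemma coeffFamily_ofCoeffFamily (Φ : Fin n → Perm (Fin n) → ℂ) :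
    coeffFamily (ofCoeffFamily Φ) = Φ := by
  funext v w
  rw [coeffFamily, ofCoeffFamily, linearCoeff_sum_mul_X, constantCoeff_C]

lemma eq_of_coeffFamily_eq {ρ ρ' : Perm (Fin n) → MvPolynomial (Fin n) ℂ}
    (hρ : ∀ w, (ρ w).IsHomogeneous 1) (hρ' : ∀ w, (ρ' w).IsHomogeneous 1)
    (h : coeffFamily ρ = coeffFamily ρ') : ρ = ρ' := by
  funext w
  refine eq_of_linearCoeff_eq (hρ w) (hρ' w) fun i => ?_
  simpa [coeffFamily] using congrFun₂ h (w⁻¹ i) w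

lemma sub_mem_span_X_sub_X_iff {ρ : Perm (Fin n) → MvPolynomial (Fin n) ℂ}
    (hρ : ∀ w, (ρ w).IsHomogeneous 1) {i j : Fin n} (hij : i ≠ j) (w : Perm (Fin n)) :
    ρ w - ρ (w * swap i j) ∈ Ideal.span {(X (w i) - X (w j) : MvPolynomial (Fin n) ℂ)} ↔
      (∀ k, k ≠ i → k ≠ j → coeffFamily ρ k (w * swap i j) = coeffFamily ρ k w) ∧
        (coeffFamily ρ i + coeffFamily ρ j) (w * swap i j) =
          (coeffFamily ρ i + coeffFamily ρ j) w := by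
  rw [mem_span_X_sub_X_iff ((hρ _).sub (hρ _)) (w.injective.ne hij)]
  simp only [Pi.add_apply, coeffFamily, Perm.mul_apply, swap_apply_left, swap_apply_right, map_sub]
  refine and_congr (w.forall_congr_right.symm.trans (forall_congr' fun k => ?_))
    ⟨fun h => by linear_combination -h, fun h => by linear_combination -h⟩
  rw [w.injective.ne_iff, w.injective.ne_iff]
  refine forall₂_congr fun hki hkj => ?_
  rw [swap_apply_of_ne_of_ne hki hkj, sub_eq_zero, eq_comm]

lemma mem_splines_iff_coeffFamily_mem {ρ : Perm (Fin n) → MvPolynomial (Fin n) ℂ}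
    (hρ : ∀ w, (ρ w).IsHomogeneous 1) : ρ ∈ splines Γ ↔ coeffFamily ρ ∈ edgeForms ℂ Γ := by
  constructor
  · intro h i j hij
    have hmem (w) := (sub_mem_span_X_sub_X_iff hρ hij.ne w).mp (h w i j hij)
    exact ⟨fun k hki hkj w => (hmem w).1 k hki hkj, fun w => (hmem w).2⟩
  · intro h w i j hij
    exact (sub_mem_span_X_sub_X_iff hρ hij.ne w).mpr
      ⟨fun k hki hkj => (h i j hij).1 k hki hkj w, (h i j hij).2 w⟩

/-- The identification of linear splines with their coefficient families. -/
noncomputable def splinesDegOneEquiv (Γ : SimpleGraph (Fin n)) :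
    splinesDeg Γ 1 ≃ₗ[ℂ] edgeForms ℂ Γ where
  toFun ρ := ⟨coeffFamily ρ.1.1, (mem_splines_iff_coeffFamily_mem ρ.2).mp ρ.1.2⟩
  map_add' _ _ := Subtype.ext (funext₂ fun _ _ => map_add _ _ _)
  map_smul' _ _ := Subtype.ext (funext₂ fun v w => map_smul (linearCoeff (w v)) _ _)
  invFun Φ := ⟨⟨ofCoeffFamily Φ.1,
    (mem_splines_iff_coeffFamily_mem (ofCoeffFamily_isHomogeneous Φ.1)).mpr
      ((coeffFamily_ofCoeffFamily Φ.1).symm ▸ Φ.2)⟩, ofCoeffFamily_isHomogeneous Φ.1⟩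
  left_inv ρ := Subtype.ext (Subtype.ext (eq_of_coeffFamily_eq (ofCoeffFamily_isHomogeneous _) ρ.2
    (coeffFamily_ofCoeffFamily _)))
  right_inv Φ := Subtype.ext (coeffFamily_ofCoeffFamily Φ.1)

instance finite_splinesDeg_one (Γ : SimpleGraph (Fin n)) : Module.Finite ℂ (splinesDeg Γ 1) :=
  Module.Finite.equiv (splinesDegOneEquiv Γ).symm

lemma constantCoeff_apply_eq_of_mem_splines (hΓ : Γ.Connected)
    {ρ : Perm (Fin n) → MvPolynomial (Fin n) ℂ} (hρ : ρ ∈ splines Γ) (w w' : Perm (Fin n)) :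
    constantCoeff (ρ w) = constantCoeff (ρ w') := by
  refine apply_eq_apply_of_forall_mem_swapInvariant (f := fun w => constantCoeff (ρ w))
    fun p q _ => mem_swapInvariant_of_reflTransGen (r := Γ.Adj) (fun i j hij w => ?_)
      ((SimpleGraph.reachable_iff_reflTransGen p q).mp (hΓ.preconnected p q))
  obtain ⟨c, hc⟩ := Ideal.mem_span_singleton'.mp (hρ w i j hij)
  have hsub : 0 = constantCoeff (ρ w) - constantCoeff (ρ (w * swap i j)) := by
    simpa using congrArg constantCoeff hc
  exact (sub_eq_zero.mp hsub.symm).symm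

section Quotient

variable {y : Fin n → splines Γ} {τ : Perm (Fin n) → Perm (Fin n)}

lemma linearIndependent_of_apply_eq_X (hy : ∀ i w, (y i).1 w = X (τ w i)) :
    LinearIndependent ℂ y := by
  refine Fintype.linearIndependent_iff.mpr fun a ha k => ?_
  have hsum : ∑ i, C (a i) * X (τ 1 i) = (0 : MvPolynomial (Fin n) ℂ) := by
    simpa [hy, smul_eq_C_mul] using congrArg (fun ρ : splines Γ => ρ.1 1) ha
  simpa [hsum] using (linearCoeff_sum_mul_X (fun i => C (a i)) (τ 1) k).symm

lemma mem_ideal_span_range_iff_mem_span (hΓ : Γ.Connected)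
    (hy : ∀ i w, (y i).1 w = X (τ w i)) {ρ : splines Γ} (hρ : ρ ∈ splinesDeg Γ 1) :
    ρ ∈ Ideal.span (Set.range y) ↔ ρ ∈ Submodule.span ℂ (Set.range y) := by
  refine ⟨fun h => ?_, fun h => Submodule.span_subset_span ℂ (splines Γ) _ h⟩
  obtain ⟨c, rfl⟩ := Ideal.mem_span_range_iff_exists_fun.mp h
  refine Submodule.mem_span_range_iff_exists_fun ℂ |>.mpr
    ⟨fun i => constantCoeff ((c i).1 1), Subtype.ext (funext fun w => ?_)⟩
  have hleft : (∑ i, constantCoeff ((c i).1 1) • y i : splines Γ).1 w =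
      ∑ i, C (constantCoeff ((c i).1 1)) * X (τ w i) := by
    simp [hy, smul_eq_C_mul]
  have hright : (∑ i, c i * y i).1 w = ∑ i, (c i).1 w * X (τ w i) := by
    simp [hy]
  rw [hleft]
  refine eq_of_linearCoeff_eq (.sum _ _ _ fun i _ => isHomogeneous_C_mul_X_one _ _) (hρ w)
    fun k => ?_
  rw [hright, ← (τ w).apply_symm_apply k, linearCoeff_sum_mul_X, linearCoeff_sum_mul_X,
    constantCoeff_C, constantCoeff_apply_eq_of_mem_splines hΓ (c _).2 1 w]

lemma finrank_map_mk_splinesDeg_one_add (hΓ : Γ.Connected) (hy : ∀ i w, (y i).1 w = X (τ w i)) :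
    Module.finrank ℂ ((splinesDeg Γ 1).map
      (Ideal.Quotient.mkₐ ℂ (Ideal.span (Set.range y))).toLinearMap) + n =
        Module.finrank ℂ (splinesDeg Γ 1) := by
  let f := (Ideal.Quotient.mkₐ ℂ (Ideal.span (Set.range y))).toLinearMap
  have hmem (i) : y i ∈ splinesDeg Γ 1 := fun w => hy i w ▸ isHomogeneous_X ℂ _
  have hker : (LinearMap.ker (f.domRestrict (splinesDeg Γ 1))).map (splinesDeg Γ 1).subtype =
      Submodule.span ℂ (Set.range y) := by
    rw [LinearMap.ker_domRestrict, Submodule.map_comap_subtype]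
    ext ρ
    have hf : ρ ∈ LinearMap.ker f ↔ ρ ∈ Ideal.span (Set.range y) := Ideal.Quotient.eq_zero_iff_mem
    rw [Submodule.mem_inf, hf]
    refine ⟨fun h => (mem_ideal_span_range_iff_mem_span hΓ hy h.1).mp h.2, fun h => ?_⟩
    have hρ := Submodule.span_le.mpr (Set.range_subset_iff.mpr hmem) h
    exact ⟨hρ, (mem_ideal_span_range_iff_mem_span hΓ hy hρ).mpr h⟩
  have hn : Module.finrank ℂ (LinearMap.ker (f.domRestrict (splinesDeg Γ 1))) = n := by
    rw [← Submodule.finrank_map_subtype_eq, hker,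
      finrank_span_eq_card (linearIndependent_of_apply_eq_X hy), Fintype.card_fin]
  have hrank := LinearMap.finrank_range_add_finrank_ker (K := ℂ) (V := splinesDeg Γ 1)
    (f.domRestrict (splinesDeg Γ 1))
  rwa [hn, LinearMap.range_domRestrict] at hrank

end Quotient

end Splines

/-! ### Blocks as subgraphs -/

section BlockSubgraph

variable {V : Type*} {Γ : SimpleGraph V}

lemma isKConnected_induce_two_iff {T : Set V} :
    IsKConnected (Γ.induce T) 2 ↔ TwoConnected Γ T := by
  have h_image (A : Set T) (S : Set V) (hS : T \ (Subtype.val '' A) = S) :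
      ((Γ.induce T).induce Aᶜ).Connected ↔ (Γ.induce S).Connected := by
    rw [← hS, ← Set.image_val_compl]
    exact SimpleGraph.Iso.connected_iff
      ⟨Equiv.Set.image Subtype.val Aᶜ Subtype.val_injective, Iff.rfl⟩
  constructor
  · exact fun h => ⟨(h_image ∅ T (by simp)).mp (h ∅ (by simp)), fun x hx =>
      (h_image {⟨x, hx⟩} (T \ {x}) (by simp)).mp (h _ (by simp))⟩
  · intro h A hA
    have hA' : A.encard ≤ 1 := Order.le_of_lt_add_one (one_add_one_eq_two (R := ℕ∞) ▸ hA)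
    rcases Set.encard_le_one_iff_eq.mp hA' with rfl | ⟨x, rfl⟩
    · exact (h_image ∅ T (by simp)).mpr h.1
    · exact (h_image {x} (T \ {↑x}) (by simp)).mpr (h.2 x x.2)

lemma IsKConnected.mono {G G' : SimpleGraph V} (h : G ≤ G') {k : ℕ} (hG : IsKConnected G k) :
    IsKConnected G' k :=
  fun A hA => (hG A hA).mono (SimpleGraph.comap_monotone _ h)

lemma IsKConnected.twoConnected_verts {H : Γ.Subgraph} (h : IsKConnected H.coe 2) :
    TwoConnected Γ H.verts :=
  isKConnected_induce_two_iff.mp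
    (IsKConnected.mono (G' := Γ.induce H.verts) (fun _ _ hab => H.adj_sub hab) h)

lemma TwoConnected.isKConnected_coe {T : Set V} (h : TwoConnected Γ T) :
    IsKConnected ((⊤ : Γ.Subgraph).induce T).coe 2 :=
  SimpleGraph.induce_eq_coe_induce_top (G := Γ) T ▸ isKConnected_induce_two_iff.mpr h

/-- The block with vertex set `B`. -/
def BlockSet.toSubgraph (B : BlockSet Γ) : Γ.Subgraph := (⊤ : Γ.Subgraph).induce B.1

lemma BlockSet.toSubgraph_injective :
    Function.Injective (BlockSet.toSubgraph : BlockSet Γ → Γ.Subgraph) :=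
  fun _ _ h => Subtype.ext (congrArg SimpleGraph.Subgraph.verts h)

lemma BlockSet.isBlock_toSubgraph (B : BlockSet Γ) : IsBlock Γ B.toSubgraph :=
  ⟨B.twoConnected.isKConnected_coe, fun _ hH hle =>
    SimpleGraph.Subgraph.le_induce_top_verts.trans
      (SimpleGraph.Subgraph.induce_mono_right (B.2.le_of_ge hH.twoConnected_verts hle.1))⟩

lemma exists_toSubgraph_eq_of_isBlock {H : Γ.Subgraph} (h : IsBlock Γ H) :
    ∃ B : BlockSet Γ, B.toSubgraph = H := by
  have hT := h.prop.twoConnected_verts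
  have hle {T : Set V} (hHT : H.verts ⊆ T) : H ≤ (⊤ : Γ.Subgraph).induce T :=
    SimpleGraph.Subgraph.le_induce_top_verts.trans (SimpleGraph.Subgraph.induce_mono_right hHT)
  exact ⟨⟨H.verts, hT, fun T hT' hHT => (h.le_of_ge hT'.isKConnected_coe (hle hHT)).1⟩,
    (h.eq_of_le hT.isKConnected_coe (hle subset_rfl)).symm⟩

/-- `B` contains exactly one cut vertex, that is, it is a leaf of the block-cut tree. -/
def BlockSet.IsLeaf (B : BlockSet Γ) : Prop := {v | v ∈ B.1 ∧ IsCutVertex Γ v}.ncard = 1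

lemma ncard_neighborSet_blockCutTree (B : BlockSet Γ) :
    ((blockCutTree Γ).neighborSet (Sum.inr ⟨B.toSubgraph, B.isBlock_toSubgraph⟩)).ncard =
      {v | v ∈ B.1 ∧ IsCutVertex Γ v}.ncard := by
  have h_inl : (blockCutTree Γ).neighborSet (Sum.inr ⟨B.toSubgraph, B.isBlock_toSubgraph⟩) =
      Sum.inl '' {v : {v : V // IsCutVertex Γ v} | v.1 ∈ B.1} := by
    ext x
    rcases x with v | C <;> simp [blockCutTree, BlockSet.toSubgraph]
  have h_val : {v | v ∈ B.1 ∧ IsCutVertex Γ v} =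
      Subtype.val '' {v : {v : V // IsCutVertex Γ v} | v.1 ∈ B.1} := by
    ext v
    simp [and_comm]
  rw [h_inl, h_val, Set.ncard_image_of_injective _ Sum.inl_injective,
    Set.ncard_image_of_injective _ Subtype.val_injective]

lemma BlockSet.toSubgraph_mem_leafBlocks_iff (B : BlockSet Γ) :
    B.toSubgraph ∈ leafBlocks Γ ↔ B.IsLeaf := by
  rw [BlockSet.IsLeaf, ← ncard_neighborSet_blockCutTree]
  exact ⟨fun ⟨_, h⟩ => h, fun h => ⟨B.isBlock_toSubgraph, h⟩⟩

lemma leafBlocks_eq_image : leafBlocks Γ = BlockSet.toSubgraph '' {B | B.IsLeaf} := by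
  ext H
  constructor
  · intro h
    obtain ⟨B, rfl⟩ := exists_toSubgraph_eq_of_isBlock h.1
    exact ⟨B, B.toSubgraph_mem_leafBlocks_iff.mp h, rfl⟩
  · rintro ⟨B, hB, rfl⟩
    exact B.toSubgraph_mem_leafBlocks_iff.mpr hB

lemma internalBlocks_eq_image : internalBlocks Γ = BlockSet.toSubgraph '' {B | ¬ B.IsLeaf} := by
  ext H
  constructor
  · rintro ⟨h, hl⟩
    obtain ⟨B, rfl⟩ := exists_toSubgraph_eq_of_isBlock h
    exact ⟨B, mt B.toSubgraph_mem_leafBlocks_iff.mpr hl, rfl⟩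
  · rintro ⟨B, hB, rfl⟩
    exact ⟨B.isBlock_toSubgraph, mt B.toSubgraph_mem_leafBlocks_iff.mp hB⟩

lemma mem_internalCutEdges_iff {s : Sym2 V} :
    s ∈ internalCutEdges Γ ↔
      s ∈ Γ.edgeSet ∧ ∃ B : BlockSet Γ, ¬ B.IsLeaf ∧ B.1 = {v | v ∈ s} := by
  simp [internalCutEdges, internalBlocks_eq_image, BlockSet.toSubgraph]

lemma ncard_leafBlocks_add_ncard_internalBlocks [Finite V] :
    (leafBlocks Γ).ncard + {B ∈ internalBlocks Γ | 2 < B.verts.ncard}.ncard =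
      {B : BlockSet Γ | B.IsLeaf ∨ 2 < B.1.ncard}.ncard := by
  have h_union : leafBlocks Γ ∪ {B ∈ internalBlocks Γ | 2 < B.verts.ncard} =
      BlockSet.toSubgraph '' {B : BlockSet Γ | B.IsLeaf ∨ 2 < B.1.ncard} := by
    rw [leafBlocks_eq_image, internalBlocks_eq_image]
    ext H
    constructor
    · rintro (⟨B, hB, rfl⟩ | ⟨⟨B, -, rfl⟩, hB⟩)
      exacts [⟨B, Or.inl hB, rfl⟩, ⟨B, Or.inr hB, rfl⟩]
    · rintro ⟨B, hB, rfl⟩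
      by_cases hl : B.IsLeaf
      exacts [Or.inl ⟨B, hl, rfl⟩, Or.inr ⟨⟨B, hl, rfl⟩, hB.resolve_left hl⟩]
  have h_disj : Disjoint (leafBlocks Γ) {B ∈ internalBlocks Γ | 2 < B.verts.ncard} :=
    Set.disjoint_left.mpr fun _ hB hB' => hB'.1.2 hB
  rw [← Set.ncard_union_eq h_disj, h_union,
    Set.ncard_image_of_injective _ BlockSet.toSubgraph_injective]

lemma BlockSet.two_le_ncard [Finite V] (B : BlockSet Γ) : 2 ≤ B.1.ncard := by
  obtain ⟨i, hi⟩ := B.twoConnected.1.nonempty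
  obtain ⟨j, hj, hij⟩ := B.twoConnected.exists_ne i
  exact (Set.one_lt_ncard (Set.toFinite _)).mpr ⟨i, hi, j, hj, hij.symm⟩

lemma BlockSet.IsLeaf.exists_not_isCutVertex [Finite V] {B : BlockSet Γ} (h : B.IsLeaf) :
    ∃ i : B.1, ¬ IsCutVertex Γ i := by
  by_contra! hcut
  have hB : {v | v ∈ B.1 ∧ IsCutVertex Γ v} = B.1 :=
    Set.ext fun v => ⟨And.left, fun hv => ⟨hv, hcut ⟨v, hv⟩⟩⟩
  rw [BlockSet.IsLeaf, hB] at h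
  exact absurd B.two_le_ncard (by omega)

lemma ncard_mem_sym2 {s : Sym2 V} (hs : ¬ s.IsDiag) : {v | v ∈ s}.ncard = 2 := by
  induction s using Sym2.ind with
  | _ i j =>
    rw [← Set.ncard_pair (mt Sym2.mk_isDiag_iff.mpr hs)]
    congr 1
    ext v
    simp

lemma BlockSet.exists_mem_edgeSet_eq {B : BlockSet Γ} (h : B.1.ncard = 2) :
    ∃ s ∈ Γ.edgeSet, B.1 = {v | v ∈ s} := by
  obtain ⟨i, j, -, hB⟩ := Set.ncard_eq_two.mp h
  obtain ⟨k, hk, hik⟩ := B.twoConnected.exists_adj (v := i) (by simp [hB])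
  obtain rfl : k = j := by
    rw [hB] at hk
    exact hk.resolve_left hik.ne.symm
  refine ⟨s(i, k), hik, hB.trans ?_⟩
  ext v
  simp

end BlockSubgraph

/-! ### The contribution of a block -/

section BlockDimension

variable {V : Type*} {Γ : SimpleGraph V} (hΓ : Γ.Connected) (B : BlockSet Γ)

section Finite

variable [Finite V]

lemma gate_eq_iff_of_not_isCutVertex {i : B.1} (hi : ¬ IsCutVertex Γ i) (p : V) :
    gate hΓ B p = i ↔ p = i := by
  refine ⟨fun h => of_not_not fun hp => ?_, fun h => h ▸ gate_of_mem hΓ B i⟩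
  obtain ⟨b, hb, hbi⟩ := B.twoConnected.exists_ne i
  have hreach : B.ReachesAvoiding i p :=
    ⟨b, hb, reachableIn_of_induce_connected (not_not.mp hi) hbi hp⟩
  exact (reachesAvoiding_iff_gate_ne hΓ B i p).mp hreach h

lemma gate_eq_of_reachable_deleteEdges {s : Sym2 V} (hB : B.1 = {v | v ∈ s}) {p q : V}
    (h : (Γ.deleteEdges {s}).Reachable p q) : gate hΓ B p = gate hΓ B q := by
  obtain ⟨W⟩ := h
  induction W with
  | nil => rfl
  | @cons a c _ hac _ ih =>
    rw [SimpleGraph.deleteEdges_adj] at hac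
    refine (gate_eq_of_adj hΓ B hac.1 fun hmem => hac.2 ?_).trans ih
    rw [hB] at hmem
    exact ((Sym2.mem_and_mem_iff hac.1.ne).mp hmem).symm

lemma reachable_deleteEdges_gate {s : Sym2 V} (hB : B.1 = {v | v ∈ s}) (p : V) :
    (Γ.deleteEdges {s}).Reachable (gate hΓ B p) p := by
  rw [SimpleGraph.reachable_iff_reflTransGen]
  refine Relation.ReflTransGen.mono ?_ _ _ (reachableIn_gate_eq hΓ B p).reflTransGen
  rintro a c ⟨hac, ha, hc⟩
  refine SimpleGraph.deleteEdges_adj.mpr ⟨hac, ?_⟩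
  rintro rfl
  have hgate (x) (hx : x ∈ s(a, c)) (hxp : gate hΓ B x = gate hΓ B p) : x = gate hΓ B p :=
    (congrArg Subtype.val ((gate_of_mem hΓ B ⟨x, hB ▸ hx⟩).symm.trans hxp) :)
  exact hac.ne ((hgate a (by simp) ha).trans (hgate c (by simp) hc).symm)

lemma supp_connectedComponentMk_deleteEdges {s : Sym2 V} (hB : B.1 = {v | v ∈ s}) (p : V) :
    ((Γ.deleteEdges {s}).connectedComponentMk p).supp = {q | gate hΓ B q = gate hΓ B p} := by
  ext q
  rw [SimpleGraph.ConnectedComponent.mem_supp_iff, SimpleGraph.ConnectedComponent.eq]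
  refine ⟨gate_eq_of_reachable_deleteEdges hΓ B hB, fun h => ?_⟩
  exact (h ▸ reachable_deleteEdges_gate hΓ B hB q).symm.trans
    (reachable_deleteEdges_gate hΓ B hB p)

end Finite

variable {K : Type*} [Field K] [Fintype V] [DecidableEq V]

lemma finrank_partitionForms_gate_add_two (h : B.IsLeaf ∨ 2 < B.1.ncard) :
    Module.finrank K (partitionForms K (gate hΓ B)) + 2 = Fintype.card V + B.1.ncard := by
  classical
  have hncard : B.1.ncard = Fintype.card B.1 := by
    rw [← Nat.card_coe_set_eq, Nat.card_eq_fintype_card]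
  rcases B.two_le_ncard.eq_or_lt with h2 | h2
  · obtain ⟨i, hi⟩ := (h.resolve_right h2.not_lt).exists_not_isCutVertex
    rw [finrank_partitionForms_of_card_eq_two (hncard.symm.trans h2.symm) _ i, ← h2]
    simp [gate_eq_iff_of_not_isCutVertex hΓ B hi, filter_eq']
  · rw [hncard] at h2 ⊢
    exact finrank_partitionForms_of_three_le_card (gate_surjective hΓ B) h2

lemma finrank_partitionForms_gate_eq_choose {s : Sym2 V} (hs : ¬ s.IsDiag)
    (hB : B.1 = {v | v ∈ s}) (C : (Γ.deleteEdges {s}).ConnectedComponent) :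
    Module.finrank K (partitionForms K (gate hΓ B)) = (Fintype.card V).choose C.supp.ncard := by
  classical
  have hcard : Fintype.card B.1 = 2 := by
    rw [← ncard_mem_sym2 hs, ← hB, ← Nat.card_coe_set_eq, Nat.card_eq_fintype_card]
  induction C using SimpleGraph.ConnectedComponent.ind with
  | _ p =>
    rw [finrank_partitionForms_of_card_eq_two hcard _ (gate hΓ B p),
      supp_connectedComponentMk_deleteEdges hΓ B hB, ← Set.ncard_coe_finset]
    simp

end BlockDimension

/-! ### Summation over the blocks -/

section Counting

variable {V : Type*} {Γ : SimpleGraph V}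

lemma cutNumber_eq_zero_of_not_isCutVertex {j : V} (hj : ¬ IsCutVertex Γ j) :
    cutNumber Γ j = 0 := by
  have hconn := not_not.mp hj
  have := hconn.preconnected.subsingleton_connectedComponent
  have := hconn.nonempty.map (Γ.induce {j}ᶜ).connectedComponentMk
  rw [cutNumber, Nat.card_unique, Nat.cast_one, sub_self]

variable [Fintype V]

open Classical in
lemma sum_ncard_blockSet_add_one (hΓ : Γ.Connected) :
    ∑ B : BlockSet Γ, B.1.ncard + 1 = Fintype.card V + Fintype.card (BlockSet Γ) := by
  rw [← sum_card_filter_mem_add_one hΓ]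
  congr 1
  have h := sum_card_bipartiteAbove_eq_sum_card_bipartiteBelow (s := univ) (t := univ)
    (fun (B : BlockSet Γ) (i : V) => i ∈ B.1)
  refine Eq.trans (sum_congr rfl fun B _ => ?_) h
  rw [bipartiteAbove, ← Set.ncard_coe_finset, coe_filter_univ, Set.ofPred_mem_eq]

open Classical in
lemma sum_cutNumber (hΓ : Γ.Connected) :
    ∑ j with IsCutVertex Γ j, cutNumber Γ j = Fintype.card (BlockSet Γ) - 1 := by
  have hcut (j : V) : cutNumber Γ j = #{B : BlockSet Γ | j ∈ B.1} - 1 := by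
    rw [cutNumber, card_connectedComponent_compl_singleton hΓ, Nat.card_eq_fintype_card,
      Fintype.card_subtype]
  have hsum := congrArg (Nat.cast : ℕ → ℤ) (sum_card_filter_mem_add_one hΓ)
  push_cast at hsum
  rw [sum_filter_of_ne fun j _ => not_imp_comm.mp cutNumber_eq_zero_of_not_isCutVertex]
  simp only [hcut, sum_sub_distrib, sum_const, card_univ, nsmul_one]
  linear_combination hsum

open Classical in
lemma sum_internalCutEdges_choose (K : Type*) [Field K] [DecidableEq V] (hΓ : Γ.Connected)
    (G : ∀ s : Sym2 V, (Γ.deleteEdges {s}).ConnectedComponent) :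
    ∑ s with s ∈ internalCutEdges Γ, (Fintype.card V).choose (G s).supp.ncard =
      ∑ B : BlockSet Γ with ¬ (B.IsLeaf ∨ 2 < B.1.ncard),
        Module.finrank K (partitionForms K (gate hΓ B)) := by
  have hmem (B : BlockSet Γ) (hB : ¬ (B.IsLeaf ∨ 2 < B.1.ncard)) :
      ∃ s ∈ internalCutEdges Γ, B.1 = {v | v ∈ s} := by
    rw [not_or, not_lt] at hB
    obtain ⟨s, hs, hBs⟩ := BlockSet.exists_mem_edgeSet_eq (hB.2.antisymm B.two_le_ncard)
    exact ⟨s, mem_internalCutEdges_iff.mpr ⟨hs, B, hB.1, hBs⟩, hBs⟩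
  choose edge hedge hverts using hmem
  refine (sum_bij (fun B hB => edge B (mem_filter.mp hB).2) ?_ ?_ ?_ ?_).symm
  · exact fun B hB => mem_filter.mpr ⟨mem_univ _, hedge B _⟩
  · intro B hB B' hB' h
    exact Subtype.ext ((hverts B (mem_filter.mp hB).2).trans (h ▸ (hverts B' _).symm))
  · intro s hs
    obtain ⟨hsΓ, B, hl, hBs⟩ := mem_internalCutEdges_iff.mp (mem_filter.mp hs).2
    have hB : ¬ (B.IsLeaf ∨ 2 < B.1.ncard) := by
      rw [hBs, ncard_mem_sym2 (Γ.not_isDiag_of_mem_edgeSet hsΓ)]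
      simp [hl]
    exact ⟨B, mem_filter.mpr ⟨mem_univ _, hB⟩,
      Sym2.ext fun v => Set.ext_iff.mp ((hverts B hB).symm.trans hBs) v⟩
  · intro B hB
    have hs := mem_internalCutEdges_iff.mp (hedge B (mem_filter.mp hB).2)
    exact finrank_partitionForms_gate_eq_choose hΓ B (Γ.not_isDiag_of_mem_edgeSet hs.1)
      (hverts B _) _

open Classical in
lemma finrank_edgeForms_eq_sum (K : Type*) [Field K] [DecidableEq V] (hΓ : Γ.Connected)
    (G : ∀ s : Sym2 V, (Γ.deleteEdges {s}).ConnectedComponent) :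
    (Module.finrank K (edgeForms K Γ) : ℤ) = 2 * Fintype.card V - 1
      - ∑ j with IsCutVertex Γ j, cutNumber Γ j
      + Fintype.card V * ((leafBlocks Γ).ncard
        + {B ∈ internalBlocks Γ | 2 < B.verts.ncard}.ncard - 1)
      + ∑ s with s ∈ internalCutEdges Γ, ((Fintype.card V).choose (G s).supp.ncard : ℤ) := by
  let P (B : BlockSet Γ) : Prop := B.IsLeaf ∨ 2 < B.1.ncard
  have hP : ∑ B with P B, Module.finrank K (partitionForms K (gate hΓ B)) + 2 * #{B | P B} =
      Fintype.card V * #{B | P B} + ∑ B with P B, B.1.ncard := by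
    rw [mul_comm 2, mul_comm (Fintype.card V), ← smul_eq_mul, ← smul_eq_mul, ← sum_const,
      ← sum_const, ← sum_add_distrib, ← sum_add_distrib]
    exact sum_congr rfl fun B hB =>
      finrank_partitionForms_gate_add_two hΓ B (mem_filter.mp hB).2
  have hnotP : ∑ B with ¬ P B, B.1.ncard = 2 * #{B | ¬ P B} := by
    rw [mul_comm, ← smul_eq_mul, ← sum_const]
    refine sum_congr rfl fun B hB => ?_
    exact (not_lt.mp (not_or.mp (mem_filter.mp hB).2).2).antisymm B.two_le_ncard
  have hverts := sum_ncard_blockSet_add_one hΓ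
  rw [← sum_filter_add_sum_filter_not _ P, hnotP] at hverts
  have hcard : #{B | P B} + #{B | ¬ P B} = Fintype.card (BlockSet Γ) :=
    card_filter_add_card_filter_not P
  have hblocks : (leafBlocks Γ).ncard + {B ∈ internalBlocks Γ | 2 < B.verts.ncard}.ncard =
      #{B | P B} := by
    rw [ncard_leafBlocks_add_ncard_internalBlocks, ← Set.ncard_coe_finset, coe_filter_univ]
  rw [sum_cutNumber hΓ, finrank_edgeForms hΓ, finrank_zeroSumForms hΓ,
    ← sum_filter_add_sum_filter_not _ P, ← sum_internalCutEdges_choose K hΓ G,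
    ← Nat.cast_add (leafBlocks Γ).ncard, hblocks]
  zify at hP hverts hcard
  push_cast
  linear_combination hP + hverts - 2 * hcard

end Counting

lemma finrank_splinesDeg_one {n : ℕ} {Γ : SimpleGraph (Fin n)} (hΓ : Γ.Connected)
    (G : ∀ s : Sym2 (Fin n), (Γ.deleteEdges {s}).ConnectedComponent) :
    (Module.finrank ℂ (splinesDeg Γ 1) : ℤ) = linDim Γ G := by
  classical
  rw [(splinesDegOneEquiv Γ).finrank_eq, finrank_edgeForms_eq_sum ℂ hΓ G, linDim, Fintype.card_fin]

end CayleySplines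

theorem mainTheorem4 {n : ℕ} (hn : 3 ≤ n) (Γ : SimpleGraph (Fin n)) (hΓ : Γ.Connected)
    (G : ∀ s : Sym2 (Fin n), (Γ.deleteEdges {s}).ConnectedComponent) :
    (Module.Finite ℂ (CayleySplines.splinesDeg Γ 1) ∧
      (Module.finrank ℂ (CayleySplines.splinesDeg Γ 1) : ℤ) = CayleySplines.linDim Γ G) ∧
    (Module.Finite ℂ (CayleySplines.leftDeg Γ 1) ∧
      (Module.finrank ℂ (CayleySplines.leftDeg Γ 1) : ℤ) = CayleySplines.linDim Γ G - n) ∧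
    (Module.Finite ℂ (CayleySplines.rightDeg Γ 1) ∧
      (Module.finrank ℂ (CayleySplines.rightDeg Γ 1) : ℤ) = CayleySplines.linDim Γ G - n) := by
  have hS := CayleySplines.finrank_splinesDeg_one hΓ G
  have hL : Module.finrank ℂ (CayleySplines.leftDeg Γ 1) + n = _ :=
    CayleySplines.finrank_map_mk_splinesDeg_one_add hΓ (y := CayleySplines.tSpline Γ)
      (τ := fun _ => 1) fun _ _ => rfl
  have hR : Module.finrank ℂ (CayleySplines.rightDeg Γ 1) + n = _ :=
    CayleySplines.finrank_map_mk_splinesDeg_one_add hΓ (y := CayleySplines.xSpline Γ)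
      (τ := id) fun _ _ => rfl
  refine ⟨⟨inferInstance, hS⟩, ⟨?_, by omega⟩, ?_, by omega⟩
  · exact Module.Finite.map (CayleySplines.splinesDeg Γ 1) _
  · exact Module.Finite.map (CayleySplines.splinesDeg Γ 1) _
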